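/- **Model.** The LevelArray for $n$ participants is an array of bits, initially $0$. Its main part is split into consecutive batches $B_0,\dots,B_{L-1}$, $L=\lfloor\log_2 n\rfloor$, where $|B_0|=\lfloor 3n/2\rfloor$ and $|B_i|=\lfloor n/2^{i+1}\rfloor$ for $i\ge 1$ (at most $2n$ locations in all); there is also a backup array of $n$ locations. A *Get* performs, for $i=0,1,\dots,L-1$ in turn, up to $c_i$ test-and-set steps, each on an independent uniformly random location of $B_i$, and, if all of these fail, test-and-set steps on the locations of the backup array in sequential order; it stops at the first successful test-and-set (one that changes a location from $0$ to $1$), and the process then holds that location. A *Free* resets the location held to $0$ in one step, a *Collect* reads all locations one after the other, and a *Call* is one step that does not access the array. An *execution* is fixed in advance by an oblivious adversary, who knows $n$ and the $c_i$ but not the random choices: it consists of an input for each of the $n$ processes (a finite sequence of Get, Free, Collect and Call operations in which Get and Free alternate, starting with a Get) and of a schedule (a sequence of process names of arbitrary length, saying which process takes each step). The number of steps (test-and-set operations) that a Get performs in the execution is then a random variable; it is $0$ for a Get that is never started. **Theorem.** Let $\alpha>1$ and $\gamma>0$. There is a constant $\kappa=\kappa(\alpha,\gamma)$ such that for every constant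 $c_{\max}$ there is a constant $C=C(\alpha,\gamma,c_{\max})>0$ with the following property. For every $A$, for all sufficiently large $n$ (depending on $\alpha,\gamma,c_{\max},A$), for all numbers of trials with $\kappa\le c_i\le c_{\max}$ for every $i$, and for every execution whose inputs contain at most $A n^{\alpha}$ Get and Free operations in total (and any numbers of Collect and Call operations): 1. the expected number of steps of each Get operation is at most $C$; 2. with probability at least $1-1/n^{\gamma}$, every Get operation of the execution takes at most $C\log_2\log_2 n$ steps. -/

import Mathlib

open scoped ENNReal

namespace LevelArray

/-! ### The shared array -/

/-- The number of locations of batch `B i` of a LevelArray for `n` participants: `⌊3n/2⌋` for the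
first batch and `⌊n / 2^(i+1)⌋` for `i ≥ 1`. -/
def batchSize (n i : ℕ) : ℕ :=
  if i = 0 then 3 * n / 2 else n / 2 ^ (i + 1)

/-- The locations of batch `B i`; the batches are laid out consecutively from location `0`. The
main array consists of the batches `B 0, …, B (⌊log₂ n⌋ - 1)`, and occupies locations below `2n`. -/
def batch (n i : ℕ) : Finset ℕ :=
  Finset.Ico (∑ k ∈ Finset.range i, batchSize n k) (∑ k ∈ Finset.range (i + 1), batchSize n k)

/-- Every batch of the main array is non-empty. -/
theorem batch_nonempty {n i : ℕ} (hi : i < Nat.log 2 n) : (batch n i).Nonempty := by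
  have hn : n ≠ 0 := by
    rintro rfl
    simp at hi
  have h2 : 2 ^ (i + 1) ≤ n := Nat.pow_le_of_le_log hn hi
  have h3 : 0 < batchSize n i := by
    unfold batchSize
    split_ifs with h
    · subst h
      simp at h2
      omega
    · exact Nat.div_pos h2 (by positivity)
  rw [batch, Finset.nonempty_Ico, Finset.sum_range_succ]
  omega

/-- A uniformly random location of batch `B i`. (The second branch is never used by the algorithm,
see `batch_nonempty`.) -/
noncomputable def randomLocation (n i : ℕ) : PMF ℕ :=
  if h : (batch n i).Nonempty then PMF.uniformOfFinset (batch n i) h else PMF.pure 0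

/-- The batches in which a `Get` makes its random trials, in order: `c 0` trials in `B 0`, then
`c 1` trials in `B 1`, and so on up to the last batch of the main array. -/
def trials (n : ℕ) (c : ℕ → ℕ) : List ℕ :=
  (List.range (Nat.log 2 n)).flatMap fun i => List.replicate (c i) i

/-- The location on which a `Get` performs its test-and-set after `s` unsuccessful ones: a uniformly
random location of the batch of trial number `s` or, once all the trials in the main array have
failed, the locations `2n, 2n + 1, …` of the backup array, sequentially. (The backup array has size
`n`; a scan of it by one of `n` participants always succeeds before its end.) -/
noncomputable def probe (n : ℕ) (c : ℕ → ℕ) (s : ℕ) : PMF ℕ :=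
  match (trials n c)[s]? with
  | some i => randomLocation n i
  | none => PMF.pure (2 * n + (s - (trials n c).length))

/-! ### Inputs and executions -/

/-- The operations that may appear in the input of a participant. -/
inductive Op
  | get
  | free
  | collect
  | call
  deriving DecidableEq

/-- `Get` and `Free` operations alternate in the list; the flag says whether an index is held
when the list starts, in which case the first of them is a `Free`, and otherwise a `Get`. -/
def Alternates : Bool → List Op → Prop
  | _, [] => True
  | h, Op.get :: l => h = false ∧ Alternates true l
  | h, Op.free :: l => h = true ∧ Alternates false l
  | h, Op.collect :: l => Alternates h l
  | h, Op.call :: l => Alternates h l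

/-- What the oblivious adversary fixes in advance: a well-formed input for each of the `n`
participants, and the schedule, where `schedule t` is the participant that takes the step number
`t`. A participant that is scheduled after it has completed its input does nothing. -/
structure Execution (n : ℕ) where
  input : Fin n → List Op
  wellFormed : ∀ q, Alternates false (input q)
  schedule : ℕ → Fin n

/-- The number of `Get` and `Free` operations that an execution contains. -/
def Execution.numGetFree {n : ℕ} (e : Execution n) : ℕ :=
  ∑ q, ((e.input q).count Op.get + (e.input q).count Op.free)

/-- A configuration of the system.
* `mem x`: the bit stored at location `x`;
* `pc q`: the position in the input of `q` of the operation that `q` executes next or currently;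
* `held q`: the index that `q` holds, if any;
* `seen q`: the indices that the last `Collect` of `q` has found so far;
* `cost q k`: the number of steps that `q` has performed in operation number `k` of its input. -/
structure Config (n : ℕ) where
  mem : ℕ → Bool
  pc : Fin n → ℕ
  held : Fin n → Option ℕ
  seen : Fin n → Finset ℕ
  cost : Fin n → ℕ → ℕ

namespace Config

variable {n : ℕ}

/-- The initial configuration: all locations are `0`, and nothing has been executed. -/
def init (n : ℕ) : Config n where
  mem := fun _ => false
  pc := fun _ => 0
  held := fun _ => none
  seen := fun _ => ∅
  cost := fun _ _ => 0

/-- Count one step of `q` in its current operation. -/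
def tick (s : Config n) (q : Fin n) : Config n :=
  let k := s.pc q
  { s with cost := Function.update s.cost q (Function.update (s.cost q) k (s.cost q k + 1)) }

/-- `q` completes its current operation. -/
def next (s : Config n) (q : Fin n) : Config n :=
  { s with pc := Function.update s.pc q (s.pc q + 1) }

/-- A step of a `Get` of `q`: test-and-set on location `x`. If `q` wins, then it holds `x` and
the `Get` is complete; if it loses, the `Get` goes on. -/
def testAndSet (s : Config n) (q : Fin n) (x : ℕ) : Config n :=
  if s.mem x then s.tick q
  else
    { (s.tick q).next q with
      mem := Function.update s.mem x true
      held := Function.update s.held q (some x) }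

/-- The single step of a `Free` of `q`: reset the location that `q` holds. -/
def reset (s : Config n) (q : Fin n) : Config n :=
  match s.held q with
  | some x =>
    { (s.tick q).next q with
      mem := Function.update s.mem x false
      held := Function.update s.held q none }
  | none => (s.tick q).next q

/-- A step of a `Collect` of `q`: its step number `x` reads location `x`. It is complete when the
`2n` locations of the main array and the `n` locations of the backup array have been read. -/
def readLocation (s : Config n) (q : Fin n) : Config n :=
  let x := s.cost q (s.pc q)
  let old := if x = 0 then ∅ else s.seen q
  let s' : Config n :=
    { s.tick q with seen := Function.update s.seen q (if s.mem x then insert x old else old) }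
  if x + 1 = 3 * n then s'.next q else s'

/-- The random configuration after a step of `q` from configuration `s`. -/
noncomputable def step (c : ℕ → ℕ) (input : Fin n → List Op) (q : Fin n) (s : Config n) :
    PMF (Config n) :=
  match (input q)[s.pc q]? with
  | none => PMF.pure s
  | some Op.get => (probe n c (s.cost q (s.pc q))).map fun x => s.testAndSet q x
  | some Op.free => PMF.pure (s.reset q)
  | some Op.collect => PMF.pure (s.readLocation q)
  | some Op.call => PMF.pure ((s.tick q).next q)

end Config

/-- The law of the configuration after the first `T` steps of an execution of the LevelArray with
`c i` trials in batch `B i`. All random choices are independent of each other, and of the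
schedule and the inputs. -/
noncomputable def Execution.law {n : ℕ} (e : Execution n) (c : ℕ → ℕ) : ℕ → PMF (Config n)
  | 0 => PMF.pure (Config.init n)
  | T + 1 => (e.law c T).bind (Config.step c e.input (e.schedule T))

/-- Operation number `k` of the input of `q` is a `Get`. -/
def Execution.IsGet {n : ℕ} (e : Execution n) (q : Fin n) (k : ℕ) : Prop :=
  (e.input q)[k]? = some Op.get

/-- The expected number of steps that `q` performs in operation number `k` of its input during the
first `T` steps of the execution. -/
noncomputable def Execution.expectedCost {n : ℕ} (e : Execution n) (c : ℕ → ℕ) (T : ℕ)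
    (q : Fin n) (k : ℕ) : ℝ≥0∞ :=
  ∑' s : Config n, e.law c T s * (s.cost q k : ℝ≥0∞)

/-- The probability that no `Get` performs more than `b` steps during the first `T` steps of the
execution. -/
noncomputable def Execution.probAllGetsWithin {n : ℕ} (e : Execution n) (c : ℕ → ℕ) (T : ℕ)
    (b : ℝ) : ℝ≥0∞ :=
  (e.law c T).toOuterMeasure {s | ∀ q k, e.IsGet q k → (s.cost q k : ℝ) ≤ b}

end LevelArray

/-! Call a configuration balanced if, for `1 ≤ i ≤ I = log₂ log₂ n` (rounded down), at most `μ i`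
participants hold a location from batch `i` on or have already lost every trial before batch `i`.
Here `μ i` is about `2^(-2^i)` times the size of batch `i`, and `μ I = 0`. In a balanced
configuration every trial fails with probability at most `7/8`, and in batch `i ≥ 1` with
probability below `2^(-2^i)`. No `Get` then goes beyond batch `I`, which gives `O(log log n)` steps,
and a geometric argument gives expected cost at most `8` (`mean_step_costPot`). It remains to show
that balance is lost only with polynomially small probability.

Dependence between the participants is handled by a potential. Fix a target time `T` and a batch `i
+ 1`. As the adversary is oblivious, the number of steps that `q` takes up to `T` is known, and so
is the time from each win to the matching `Free`. A `Get` therefore matters at time `T` only if it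
loses a determined number `m` of test-and-sets, and successive `Get` operations of `q` have strictly
decreasing `m`. Their contributions form a geometric series with sum at most `8 * η^(c i)`, however
many operations precede `T` (`Level.geom_le`). `Level.pot` is the resulting bound on the conditional
probability that `q` is past the batch at time `T`; it does not increase in the mean along steps
from balanced configurations (`Level.mean_step_of_get`, `Level.pot_step_of_ne_get`). A step of `q`
changes only the potential of `q`, so the product of `1 + r * pot` over all participants is a
supermartingale too, and Markov's inequality yields a Chernoff bound as if the participants were
independent (`Thresholds.mean_card_le`).

The induction over time is replaced by killing the chain when it leaves the balanced set. Balance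
can be lost only in a losing step of a `Get`. Such steps occur at polynomially many possible times,
although `Collect` and `Call` operations are unlimited, because other operations have fixed lengths
(`Execution.card_getTime_le`). A union bound over these times and the levels finishes the proof. On
the bad event the expected cost is controlled by the deterministic bound from the backup array
(`Move.backupBound`). -/

open scoped NNReal

namespace LevelArray

/-! ### Inhomogeneous Markov chains and killing. -/

section Chain

variable {S : Type*}

/-- The law of a time-inhomogeneous Markov chain started at `s₀`. -/
noncomputable def chain (s₀ : S) (K : ℕ → S → PMF S) : ℕ → PMF S
  | 0 => PMF.pure s₀
  | t + 1 => (chain s₀ K t).bind (K t)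

open Classical in
/-- The (sub-probability) law of the chain that is killed when it leaves a state outside `G`. -/
noncomputable def killed (s₀ : S) (K : ℕ → S → PMF S) (G : Set S) : ℕ → S → ℝ≥0∞
  | 0 => fun s => PMF.pure s₀ s
  | t + 1 => fun s' => ∑' s, (if s ∈ G then killed s₀ K G t s else 0) * K t s s'

/-- The sum of `f` against a weight. -/
noncomputable def mean (p f : S → ℝ≥0∞) : ℝ≥0∞ := ∑' s, p s * f s

theorem mean_mono_of_support {p f g : S → ℝ≥0∞} (h : ∀ s, p s ≠ 0 → f s ≤ g s) :
    mean p f ≤ mean p g := by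
  refine ENNReal.tsum_le_tsum fun s => ?_
  by_cases hs : p s = 0
  · simp [hs]
  · exact mul_le_mul_right (h s hs) _

theorem mean_add (p f g : S → ℝ≥0∞) : mean p (fun s => f s + g s) = mean p f + mean p g := by
  simp only [mean, mul_add, ENNReal.tsum_add]

theorem mean_const_mul (p f : S → ℝ≥0∞) (a : ℝ≥0∞) :
    mean p (fun s => a * f s) = a * mean p f := by
  simp only [mean, ← ENNReal.tsum_mul_left]
  exact tsum_congr fun s => by ring

theorem mean_const (p : PMF S) (a : ℝ≥0∞) : mean p (fun _ => a) = a := by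
  simp only [mean, ENNReal.tsum_mul_right, PMF.tsum_coe, one_mul]

theorem mean_le_of_support {p : PMF S} {f : S → ℝ≥0∞} {a : ℝ≥0∞} (h : ∀ s ∈ p.support, f s ≤ a) :
    mean p f ≤ a :=
  (mean_mono_of_support fun s hs => h s ((PMF.mem_support_iff _ _).2 hs)).trans (mean_const p a).le

theorem mean_pure (a : S) (f : S → ℝ≥0∞) : mean (PMF.pure a) f = f a := by
  classical
  rw [mean, tsum_eq_single a]
  · simp
  · intro b hb
    simp [hb]

theorem mean_tsum {ι : Type*} (w : ι → ℝ≥0∞) (p : ι → S → ℝ≥0∞) (f : S → ℝ≥0∞) :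
    mean (fun s => ∑' i, w i * p i s) f = ∑' i, w i * mean (p i) f := by
  simp only [mean, ← ENNReal.tsum_mul_right, ← ENNReal.tsum_mul_left]
  rw [ENNReal.tsum_comm]
  exact tsum_congr fun i => tsum_congr fun s => by ring

theorem mean_bind {R : Type*} (p : PMF R) (k : R → PMF S) (f : S → ℝ≥0∞) :
    mean (p.bind k) f = mean p (fun r => mean (k r) f) := by
  have h : (⇑(p.bind k) : S → ℝ≥0∞) = fun s => ∑' r, p r * k r s := by
    funext s
    exact PMF.bind_apply _ _ _
  rw [h, mean_tsum]
  rfl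

theorem mean_map {R : Type*} (p : PMF R) (g : R → S) (f : S → ℝ≥0∞) :
    mean (p.map g) f = mean p (fun r => f (g r)) := by
  rw [PMF.map, mean_bind]
  simp [mean_pure]

variable {s₀ : S} {K : ℕ → S → PMF S} {G : Set S}

open Classical in
theorem mean_killed_succ (t : ℕ) (f : S → ℝ≥0∞) :
    mean (killed s₀ K G (t + 1)) f =
      mean (killed s₀ K G t) (fun s => if s ∈ G then mean (K t s) f else 0) := by
  rw [killed, mean_tsum]
  refine tsum_congr fun s => ?_
  by_cases hG : s ∈ G <;> simp [hG]

/-- Mass leaves a state only if the state lies in `G`, so the inductive step may assume `s ∈ G`. The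
state reached need not lie in `G`: at time `t` the killed law still carries the mass that has just
left `G`. -/
theorem killed_invariant {I : ℕ → S → Prop} (h0 : I 0 s₀)
    (hstep : ∀ t s, I t s → s ∈ G → ∀ s' ∈ (K t s).support, I (t + 1) s') (t : ℕ) :
    ∀ s, killed s₀ K G t s ≠ 0 → I t s := by
  induction t with
  | zero =>
    intro s hs
    have hs' : s ∈ (PMF.pure s₀).support := hs
    simp only [PMF.support_pure, Set.mem_singleton_iff] at hs'
    exact hs' ▸ h0
  | succ t ih =>
    intro s hs
    rw [killed, ne_eq, ENNReal.tsum_eq_zero, not_forall] at hs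
    obtain ⟨r, hr⟩ := hs
    split_ifs at hr with hG
    · rw [mul_eq_zero, not_or] at hr
      exact hstep t r (ih r hr.1) hG s hr.2
    · simp at hr

/-- A function that decreases in the mean at every step from a state of `G` decreases in the mean
along the killed chain. -/
theorem mean_killed_le {I : ℕ → S → Prop} (h0 : I 0 s₀)
    (hstep : ∀ t s, I t s → s ∈ G → ∀ s' ∈ (K t s).support, I (t + 1) s')
    {f : ℕ → S → ℝ≥0∞} {T : ℕ}
    (hf : ∀ t < T, ∀ s, I t s → s ∈ G → mean (K t s) (f (t + 1)) ≤ f t s) :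
    mean (killed s₀ K G T) (f T) ≤ f 0 s₀ := by
  classical
  suffices h : ∀ t ≤ T, mean (killed s₀ K G t) (f t) ≤ f 0 s₀ from h T le_rfl
  intro t
  induction t with
  | zero =>
    intro _
    exact (mean_pure s₀ (f 0)).le
  | succ t ih =>
    intro ht
    rw [mean_killed_succ]
    refine le_trans (mean_mono_of_support fun s hs => ?_) (ih (by omega))
    split_ifs with hG
    · exact hf t (by omega) s (killed_invariant h0 hstep t s hs) hG
    · exact zero_le

/-- Killing the chain outside `G` costs at most the mass that is killed. -/
theorem mean_chain_le {I : ℕ → S → Prop} (h0 : I 0 s₀)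
    (hstep : ∀ t s, I t s → ∀ s' ∈ (K t s).support, I (t + 1) s') (B : ℝ≥0∞) (T : ℕ)
    (f : S → ℝ≥0∞) (hf : ∀ s, I T s → f s ≤ B) :
    mean (chain s₀ K T) f ≤ mean (killed s₀ K G T) f +
      B * ∑ t ∈ Finset.range T, mean (killed s₀ K G t) (Gᶜ.indicator 1) := by
  classical
  induction T generalizing f with
  | zero => exact le_self_add
  | succ T ih =>
    -- The induction replaces `f` by its average over the last step, for which the same bound `B`
    -- holds one step earlier.
    have hK : ∀ s, I T s → mean (K T s) f ≤ B := fun s hs =>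
      mean_le_of_support fun s' hs' => hf s' (hstep T s hs s' hs')
    rw [chain, mean_bind, mean_killed_succ, Finset.sum_range_succ, mul_add,
      add_comm (B * Finset.sum _ _), ← add_assoc]
    refine (ih _ hK).trans ?_
    gcongr
    rw [← mean_const_mul, ← mean_add]
    refine mean_mono_of_support fun s hs => ?_
    have hI := killed_invariant (G := G) h0 (fun t s h _ => hstep t s h) T s hs
    by_cases hG : s ∈ G
    · simp [hG]
    · simpa [hG] using hK s hI

end Chain

/-! ### Trials and probes -/

/-- The number of trials that a `Get` makes before it reaches batch `i`. -/
def trialStart (c : ℕ → ℕ) (i : ℕ) : ℕ := ∑ k ∈ Finset.range i, c k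

/-- The first location of batch `i`. -/
def batchStart (n i : ℕ) : ℕ := ∑ k ∈ Finset.range i, batchSize n k

theorem trialStart_mono (c : ℕ → ℕ) : Monotone (trialStart c) := fun _ _ h =>
  Finset.sum_le_sum_of_subset (Finset.range_mono h)

theorem batchStart_mono (n : ℕ) : Monotone (batchStart n) := fun _ _ h =>
  Finset.sum_le_sum_of_subset (Finset.range_mono h)

theorem trialStart_succ (c : ℕ → ℕ) (i : ℕ) : trialStart c (i + 1) = trialStart c i + c i :=
  Finset.sum_range_succ _ _

theorem mem_batch {n i x : ℕ} : x ∈ batch n i ↔ batchStart n i ≤ x ∧ x < batchStart n (i + 1) :=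
  Finset.mem_Ico

theorem card_batch (n i : ℕ) : (batch n i).card = batchSize n i := by
  simp [batch, Finset.sum_range_succ]

theorem batchStart_le (n j : ℕ) : batchStart n j ≤ 2 * n := by
  -- The extra term halves, with rounding down, at each step and thereby pays for the next batch.
  have h : ∀ j, batchStart n (j + 1) + n / 2 ^ (j + 1) ≤ 2 * n := by
    intro j
    induction j with
    | zero => simp [batchStart, batchSize]; omega
    | succ j ih =>
      have h1 : n / 2 ^ (j + 2) = n / 2 ^ (j + 1) / 2 := by rw [Nat.div_div_eq_div_mul, pow_succ]
      have h2 : batchStart n (j + 1 + 1) = batchStart n (j + 1) + n / 2 ^ (j + 2) := by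
        rw [batchStart, Finset.sum_range_succ, batchStart]
        simp [batchSize]
      have h3 : n / 2 ^ (j + 1 + 1) = n / 2 ^ (j + 2) := rfl
      omega
  exact (batchStart_mono n (Nat.le_succ j)).trans ((Nat.le_add_right _ _).trans (h j))

theorem length_flatMap_replicate (c : ℕ → ℕ) (m : ℕ) :
    ((List.range m).flatMap fun i => List.replicate (c i) i).length = trialStart c m := by
  induction m with
  | zero => rfl
  | succ m ih =>
    rw [List.range_succ, List.flatMap_append, List.length_append, ih, trialStart_succ]
    simp

theorem getElem?_flatMap_replicate (c : ℕ → ℕ) {m i f : ℕ} (hi : i < m)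
    (h1 : trialStart c i ≤ f) (h2 : f < trialStart c (i + 1)) :
    ((List.range m).flatMap fun i => List.replicate (c i) i)[f]? = some i := by
  induction m with
  | zero => omega
  | succ m ih =>
    rw [List.range_succ, List.flatMap_append]
    rcases Nat.lt_succ_iff_lt_or_eq.1 hi with h | rfl
    · rw [List.getElem?_append_left]
      · exact ih h
      · rw [length_flatMap_replicate]
        exact h2.trans_le (trialStart_mono c h)
    · rw [List.getElem?_append_right (by rwa [length_flatMap_replicate]), length_flatMap_replicate]
      rw [trialStart_succ] at h2
      simp only [List.flatMap_cons, List.flatMap_nil, List.append_nil]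
      rw [List.getElem?_replicate, if_pos (by omega)]

theorem length_trials (n : ℕ) (c : ℕ → ℕ) :
    (trials n c).length = trialStart c (Nat.log 2 n) :=
  length_flatMap_replicate c _

theorem trials_getElem? {n : ℕ} {c : ℕ → ℕ} {i f : ℕ} (hi : i < Nat.log 2 n)
    (h1 : trialStart c i ≤ f) (h2 : f < trialStart c (i + 1)) : (trials n c)[f]? = some i :=
  getElem?_flatMap_replicate c hi h1 h2

theorem exists_batch_of_lt {c : ℕ → ℕ} {m f : ℕ} (h : f < trialStart c m) :
    ∃ i < m, trialStart c i ≤ f ∧ f < trialStart c (i + 1) := by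
  induction m with
  | zero => simp [trialStart] at h
  | succ m ih =>
    by_cases hf : f < trialStart c m
    · obtain ⟨i, hi, h'⟩ := ih hf
      exact ⟨i, by omega, h'⟩
    · exact ⟨m, by omega, by omega, h⟩

theorem probe_of_trial {n : ℕ} {c : ℕ → ℕ} {i f : ℕ} (hi : i < Nat.log 2 n)
    (h1 : trialStart c i ≤ f) (h2 : f < trialStart c (i + 1)) :
    probe n c f = PMF.uniformOfFinset (batch n i) (batch_nonempty hi) := by
  rw [probe, trials_getElem? hi h1 h2]
  exact dif_pos (batch_nonempty hi)

theorem probe_of_backup {n : ℕ} {c : ℕ → ℕ} {f : ℕ} (h : (trials n c).length ≤ f) :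
    probe n c f = PMF.pure (2 * n + (f - (trials n c).length)) := by
  rw [probe, List.getElem?_eq_none h]

/-- A test-and-set that precedes the trials in batch `i` accesses a location before batch `i`. -/
theorem lt_batchStart_of_mem_support_probe {n : ℕ} {c : ℕ → ℕ} {i f x : ℕ} (hi : i ≤ Nat.log 2 n)
    (hf : f < trialStart c i) (hx : x ∈ (probe n c f).support) : x < batchStart n i := by
  obtain ⟨j, hj, h1, h2⟩ := exists_batch_of_lt hf
  rw [probe_of_trial (hj.trans_le hi) h1 h2, PMF.support_uniformOfFinset, Finset.mem_coe,
    mem_batch] at hx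
  exact hx.2.trans_le (batchStart_mono n hj)

theorem lt_of_mem_support_probe_backup {n : ℕ} {c : ℕ → ℕ} {y f x : ℕ}
    (hf : f < (trials n c).length + y) (hx : x ∈ (probe n c f).support) : x < 2 * n + y := by
  by_cases h : f < (trials n c).length
  · rw [length_trials] at h
    have := lt_batchStart_of_mem_support_probe le_rfl h hx
    have := batchStart_le n (Nat.log 2 n)
    omega
  · rw [probe_of_backup (not_lt.1 h), PMF.support_pure, Set.mem_singleton_iff] at hx
    omega

/-! ### The steps of an execution -/

theorem drop_of_getElem? {β : Type*} {l : List β} {k : ℕ} {a : β} (h : l[k]? = some a) :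
    l.drop k = a :: l.drop (k + 1) := by
  obtain ⟨hk, rfl⟩ := List.getElem?_eq_some_iff.1 h
  exact List.drop_eq_getElem_cons hk

variable {n : ℕ}

/-- `s'` is the configuration `s` in which `q` has spent a step in its current operation. -/
structure Spends (q : Fin n) (s s' : Config n) : Prop where
  cost : s'.cost = Function.update s.cost q
    (Function.update (s.cost q) (s.pc q) (s.cost q (s.pc q) + 1))

/-- The possible effects of a step of `q`. -/
inductive Move (c : ℕ → ℕ) (input : Fin n → List Op) (q : Fin n) (s s' : Config n) : Prop
  | idle (hop : (input q)[s.pc q]? = none) (heq : s' = s)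
  | lose (hop : (input q)[s.pc q]? = some Op.get) (x : ℕ)
      (hx : x ∈ (probe n c (s.cost q (s.pc q))).support) (hm : s.mem x = true)
      (hmem : s'.mem = s.mem) (hpc : s'.pc = s.pc) (hheld : s'.held = s.held)
      (hcost : Spends q s s')
  | win (hop : (input q)[s.pc q]? = some Op.get) (x : ℕ)
      (hx : x ∈ (probe n c (s.cost q (s.pc q))).support) (hm : s.mem x = false)
      (hmem : s'.mem = Function.update s.mem x true)
      (hpc : s'.pc = Function.update s.pc q (s.pc q + 1))
      (hheld : s'.held = Function.update s.held q (some x)) (hcost : Spends q s s')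
  | release (hop : (input q)[s.pc q]? = some Op.free) (x : ℕ) (hx : s.held q = some x)
      (hmem : s'.mem = Function.update s.mem x false)
      (hpc : s'.pc = Function.update s.pc q (s.pc q + 1))
      (hheld : s'.held = Function.update s.held q none) (hcost : Spends q s s')
  | read (hop : (input q)[s.pc q]? = some Op.collect) (hlt : s.cost q (s.pc q) + 1 ≠ 3 * n)
      (hmem : s'.mem = s.mem) (hpc : s'.pc = s.pc) (hheld : s'.held = s.held)
      (hcost : Spends q s s')
  | pass (hop : (input q)[s.pc q]? = some Op.call ∨
        (input q)[s.pc q]? = some Op.collect ∧ s.cost q (s.pc q) + 1 = 3 * n)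
      (hmem : s'.mem = s.mem) (hpc : s'.pc = Function.update s.pc q (s.pc q + 1))
      (hheld : s'.held = s.held) (hcost : Spends q s s')

/-- The part of a configuration that every step preserves. -/
structure WellFormed (input : Fin n → List Op) (s : Config n) : Prop where
  alternates : ∀ q, Alternates (s.held q).isSome ((input q).drop (s.pc q))
  cost_future : ∀ q k, s.pc q < k → s.cost q k = 0
  cost_collect : ∀ q, (input q)[s.pc q]? = some Op.collect → s.cost q (s.pc q) < 3 * n
  cost_now : ∀ q, (input q)[s.pc q]? ≠ some Op.get → (input q)[s.pc q]? ≠ some Op.collect →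
    s.cost q (s.pc q) = 0
  mem_iff : ∀ x, s.mem x = true ↔ ∃ q, s.held q = some x
  held_inj : ∀ q q' x, s.held q = some x → s.held q' = some x → q = q'

theorem WellFormed.held_eq_none {input : Fin n → List Op} {s : Config n} (h : WellFormed input s)
    {q : Fin n} (hop : (input q)[s.pc q]? = some Op.get) : s.held q = none := by
  have := h.alternates q
  rw [drop_of_getElem? hop, Alternates] at this
  simpa using this.1

theorem WellFormed.held_ne_none {input : Fin n → List Op} {s : Config n} (h : WellFormed input s)
    {q : Fin n} (hop : (input q)[s.pc q]? = some Op.free) : ∃ x, s.held q = some x := by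
  have := h.alternates q
  rw [drop_of_getElem? hop, Alternates] at this
  exact Option.isSome_iff_exists.1 this.1

theorem move_testAndSet {c : ℕ → ℕ} {input : Fin n → List Op} {q : Fin n} {s : Config n}
    (hop : (input q)[s.pc q]? = some Op.get) {x : ℕ}
    (hx : x ∈ (probe n c (s.cost q (s.pc q))).support) : Move c input q s (s.testAndSet q x) := by
  cases hm : s.mem x with
  | true =>
    rw [Config.testAndSet, if_pos hm]
    exact Move.lose hop x hx hm rfl rfl rfl ⟨rfl⟩
  | false =>
    rw [Config.testAndSet, if_neg (by simp [hm])]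
    exact Move.win hop x hx hm rfl rfl rfl ⟨rfl⟩

theorem move_of_mem_support {c : ℕ → ℕ} {input : Fin n → List Op} {q : Fin n} {s s' : Config n}
    (h : WellFormed input s) (hs' : s' ∈ (Config.step c input q s).support) :
    Move c input q s s' := by
  unfold Config.step at hs'
  rcases hop : (input q)[s.pc q]? with _ | op
  · simp only [hop, PMF.support_pure, Set.mem_singleton_iff] at hs'
    exact Move.idle hop hs'
  cases op with
  | get =>
    simp only [hop, PMF.support_map, Set.mem_image] at hs'
    obtain ⟨x, hx, rfl⟩ := hs'
    exact move_testAndSet hop hx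
  | free =>
    simp only [hop, PMF.support_pure, Set.mem_singleton_iff] at hs'
    obtain ⟨x, hx⟩ := h.held_ne_none hop
    simp only [Config.reset, hx] at hs'
    subst hs'
    exact Move.release hop x hx rfl rfl rfl ⟨rfl⟩
  | collect =>
    simp only [hop, PMF.support_pure, Set.mem_singleton_iff] at hs'
    subst hs'
    by_cases hl : s.cost q (s.pc q) + 1 = 3 * n
    · refine Move.pass (Or.inr ⟨hop, hl⟩) ?_ ?_ ?_ ⟨?_⟩ <;>
        simp [Config.readLocation, hl, Config.tick, Config.next]
    · refine Move.read hop hl ?_ ?_ ?_ ⟨?_⟩ <;>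
        simp [Config.readLocation, hl, Config.tick]
  | call =>
    simp only [hop, PMF.support_pure, Set.mem_singleton_iff] at hs'
    subst hs'
    exact Move.pass (Or.inl hop) rfl rfl rfl ⟨rfl⟩

theorem Spends.cost_of_ne {q q' : Fin n} {s s' : Config n} (h : Spends q s s') (hq : q' ≠ q) :
    s'.cost q' = s.cost q' := by
  rw [h.cost, Function.update_of_ne hq]

theorem Spends.cost_self {q : Fin n} {s s' : Config n} (h : Spends q s s') :
    s'.cost q (s.pc q) = s.cost q (s.pc q) + 1 := by
  rw [h.cost, Function.update_self, Function.update_self]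

theorem Spends.cost_self_of_ne {q : Fin n} {s s' : Config n} (h : Spends q s s') {k : ℕ}
    (hk : k ≠ s.pc q) : s'.cost q k = s.cost q k := by
  rw [h.cost, Function.update_self, Function.update_of_ne hk]

/-- A step of `q` changes neither the position nor the costs nor the index of the others. -/
theorem Move.frame {c : ℕ → ℕ} {input : Fin n → List Op} {q : Fin n} {s s' : Config n}
    (h : Move c input q s s') {q' : Fin n} (hq : q' ≠ q) :
    s'.pc q' = s.pc q' ∧ s'.held q' = s.held q' ∧ s'.cost q' = s.cost q' := by
  cases h with
  | idle hop heq => simp [heq]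
  | lose hop x hx hm hmem hpc hheld hcost => exact ⟨by rw [hpc], by rw [hheld], hcost.cost_of_ne hq⟩
  | win hop x hx hm hmem hpc hheld hcost =>
    exact ⟨by rw [hpc, Function.update_of_ne hq], by rw [hheld, Function.update_of_ne hq],
      hcost.cost_of_ne hq⟩
  | release hop x hx hmem hpc hheld hcost =>
    exact ⟨by rw [hpc, Function.update_of_ne hq], by rw [hheld, Function.update_of_ne hq],
      hcost.cost_of_ne hq⟩
  | read hop hlt hmem hpc hheld hcost => exact ⟨by rw [hpc], by rw [hheld], hcost.cost_of_ne hq⟩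
  | pass hop hmem hpc hheld hcost =>
    exact ⟨by rw [hpc, Function.update_of_ne hq], by rw [hheld], hcost.cost_of_ne hq⟩

theorem wellFormed_init {input : Fin n → List Op}
    (h : ∀ q, Alternates false (input q)) :
    WellFormed input (Config.init n) where
  alternates q := by simpa [Config.init] using h q
  cost_future _ _ _ := rfl
  cost_collect q _ := by have := q.pos; simp [Config.init]; omega
  cost_now _ _ _ := rfl
  mem_iff x := by simp [Config.init]
  held_inj q q' x h := by simp [Config.init] at h

theorem Spends.cost_succ_pc {input : Fin n → List Op} {q : Fin n} {s s' : Config n}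
    (h : WellFormed input s) (hs : Spends q s s') {k : ℕ} (hk : s.pc q + 1 ≤ k) :
    s'.cost q k = 0 := by
  rw [hs.cost_self_of_ne (by omega), h.cost_future q k (by omega)]

theorem Move.cost_future {c : ℕ → ℕ} {input : Fin n → List Op} {q : Fin n} {s s' : Config n}
    (h : WellFormed input s) (hm : Move c input q s s') {k : ℕ} (hk : s'.pc q < k) :
    s'.cost q k = 0 := by
  cases hm with
  | idle hop heq => exact h.cost_future q k (heq ▸ hk) |> fun h => by rw [heq, h]
  | lose hop x hx hm hmem hpc hheld hcost =>
    rw [hpc] at hk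
    exact hcost.cost_succ_pc h hk
  | win hop x hx hm hmem hpc hheld hcost =>
    rw [hpc, Function.update_self] at hk
    exact hcost.cost_succ_pc h (by omega)
  | release hop x hx hmem hpc hheld hcost =>
    rw [hpc, Function.update_self] at hk
    exact hcost.cost_succ_pc h (by omega)
  | read hop hlt hmem hpc hheld hcost =>
    rw [hpc] at hk
    exact hcost.cost_succ_pc h hk
  | pass hop hmem hpc hheld hcost =>
    rw [hpc, Function.update_self] at hk
    exact hcost.cost_succ_pc h (by omega)

/-- The cost of the current operation after a step: `q` has just begun it, or it is a `Get` that
lost or a `Collect` that has not yet read all locations. -/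
theorem Move.cost_current {c : ℕ → ℕ} {input : Fin n → List Op} {q : Fin n} {s s' : Config n}
    (h : WellFormed input s) (hm : Move c input q s s') :
    s'.cost q (s'.pc q) = 0 ∨ (input q)[s'.pc q]? = some Op.get ∨
      (input q)[s'.pc q]? = some Op.collect ∧ s'.cost q (s'.pc q) < 3 * n := by
  cases hm with
  | idle hop heq =>
    left
    rw [heq]
    exact h.cost_now q (by simp [hop]) (by simp [hop])
  | lose hop x hx hm hmem hpc hheld hcost => exact Or.inr (Or.inl (by rw [hpc, hop]))
  | win hop x hx hm hmem hpc hheld hcost =>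
    left
    rw [hpc, Function.update_self]
    exact hcost.cost_succ_pc h le_rfl
  | release hop x hx hmem hpc hheld hcost =>
    left
    rw [hpc, Function.update_self]
    exact hcost.cost_succ_pc h le_rfl
  | read hop hlt hmem hpc hheld hcost =>
    right; right
    rw [hpc, hcost.cost_self]
    have := h.cost_collect q hop
    exact ⟨hop, by omega⟩
  | pass hop hmem hpc hheld hcost =>
    left
    rw [hpc, Function.update_self]
    exact hcost.cost_succ_pc h le_rfl

theorem Move.alternates {c : ℕ → ℕ} {input : Fin n → List Op} {q : Fin n} {s s' : Config n}
    (h : WellFormed input s) (hm : Move c input q s s') :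
    Alternates (s'.held q).isSome ((input q).drop (s'.pc q)) := by
  have ha := h.alternates q
  cases hm with
  | idle hop heq => rwa [heq]
  | lose hop x hx hm hmem hpc hheld hcost => rwa [hheld, hpc]
  | win hop x hx hm hmem hpc hheld hcost =>
    rw [drop_of_getElem? hop] at ha
    rw [hheld, hpc, Function.update_self, Function.update_self]
    exact ha.2
  | release hop x hx hmem hpc hheld hcost =>
    rw [drop_of_getElem? hop] at ha
    rw [hheld, hpc, Function.update_self, Function.update_self]
    exact ha.2
  | read hop hlt hmem hpc hheld hcost => rwa [hheld, hpc]
  | pass hop hmem hpc hheld hcost =>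
    rw [hheld, hpc, Function.update_self]
    rcases hop with hop | ⟨hop, -⟩ <;>
    · rw [drop_of_getElem? hop] at ha
      exact ha

theorem Move.mem_iff {c : ℕ → ℕ} {input : Fin n → List Op} {q : Fin n} {s s' : Config n}
    (h : WellFormed input s) (hm : Move c input q s s') :
    (∀ x, s'.mem x = true ↔ ∃ q, s'.held q = some x) ∧
      ∀ q q' x, s'.held q = some x → s'.held q' = some x → q = q' := by
  cases hm with
  | idle hop heq => exact heq ▸ ⟨h.mem_iff, h.held_inj⟩
  | lose hop x hx hm hmem hpc hheld hcost => rw [hmem, hheld]; exact ⟨h.mem_iff, h.held_inj⟩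
  | read hop hlt hmem hpc hheld hcost => rw [hmem, hheld]; exact ⟨h.mem_iff, h.held_inj⟩
  | pass hop hmem hpc hheld hcost => rw [hmem, hheld]; exact ⟨h.mem_iff, h.held_inj⟩
  | win hop x hx hm hmem hpc hheld hcost =>
    have hn := h.held_eq_none hop
    have hf : ∀ q', s.held q' ≠ some x := fun q' hq' => by
      simp [(h.mem_iff x).2 ⟨q', hq'⟩] at hm
    have key : ∀ q' y, s'.held q' = some y ↔ q' = q ∧ y = x ∨ s.held q' = some y := by
      intro q' y
      rw [hheld]
      by_cases hq : q' = q
      · subst hq; simp [hn, eq_comm]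
      · simp [hq]
    refine ⟨fun y => ?_, fun q₁ q₂ y h1 h2 => ?_⟩
    · simp only [key, exists_or, exists_eq_left, ← h.mem_iff, hmem, Function.update_apply]
      by_cases hy : y = x <;> simp [hy]
    · rw [key] at h1 h2
      rcases h1 with ⟨rfl, rfl⟩ | h1 <;> rcases h2 with ⟨rfl, h2'⟩ | h2
      · rfl
      · exact absurd h2 (hf _)
      · exact absurd (h2' ▸ h1) (hf _)
      · exact h.held_inj _ _ _ h1 h2
  | release hop x hx hmem hpc hheld hcost =>
    have key : ∀ q' y, s'.held q' = some y ↔ q' ≠ q ∧ s.held q' = some y := by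
      intro q' y
      rw [hheld]
      by_cases hq : q' = q
      · subst hq; simp
      · simp [hq]
    refine ⟨fun y => ?_, fun q₁ q₂ y h1 h2 => h.held_inj _ _ y ((key _ _).1 h1).2 ((key _ _).1 h2).2⟩
    simp only [key, hmem, Function.update_apply]
    by_cases hy : y = x
    · subst hy
      simp only [if_true, Bool.false_eq_true, false_iff, not_exists, not_and]
      exact fun q' hq' hy => hq' (h.held_inj _ _ _ hy hx)
    · rw [if_neg hy, h.mem_iff]
      refine exists_congr fun q' => ⟨fun h' => ⟨?_, h'⟩, fun h' => h'.2⟩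
      rintro rfl
      exact hy (Option.some.inj (h'.symm.trans hx))

theorem Move.wellFormed {c : ℕ → ℕ} {input : Fin n → List Op} {q : Fin n} {s s' : Config n}
    (h : WellFormed input s) (hm : Move c input q s s') : WellFormed input s' where
  alternates q' := by
    by_cases hq : q' = q
    · exact hq ▸ hm.alternates h
    · obtain ⟨h1, h2, h3⟩ := hm.frame hq
      rw [h1, h2]
      exact h.alternates q'
  cost_future q' k hk := by
    by_cases hq : q' = q
    · subst hq
      exact hm.cost_future h hk
    · obtain ⟨h1, h2, h3⟩ := hm.frame hq
      rw [h1] at hk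
      rw [h3]
      exact h.cost_future q' k hk
  cost_collect q' hop := by
    by_cases hq : q' = q
    · subst hq
      rcases hm.cost_current h with h1 | h1 | h1
      · have := q'.pos
        omega
      · simp [h1] at hop
      · exact h1.2
    · obtain ⟨h1, h2, h3⟩ := hm.frame hq
      rw [h1] at hop
      rw [h1, h3]
      exact h.cost_collect q' hop
  cost_now q' h4 h5 := by
    by_cases hq : q' = q
    · subst hq
      rcases hm.cost_current h with h1 | h1 | h1
      · exact h1
      · exact absurd h1 h4
      · exact absurd h1.1 h5
    · obtain ⟨h1, h2, h3⟩ := hm.frame hq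
      rw [h1] at h4 h5
      rw [h1, h3]
      exact h.cost_now q' h4 h5
  mem_iff := (hm.mem_iff h).1
  held_inj := (hm.mem_iff h).2

/-! ### Participants that have advanced far into the array -/

/-- Participant `q` holds a location from `a` on, or is in a `Get` in which it has already made
`b` unsuccessful test-and-sets. -/
def Past (input : Fin n → List Op) (s : Config n) (a b : ℕ) (q : Fin n) : Prop :=
  match s.held q with
  | some x => a ≤ x
  | none => (input q)[s.pc q]? = some Op.get ∧ b ≤ s.cost q (s.pc q)

open Classical in
/-- The participants that hold a location from `a` on, or have already made `b` unsuccessful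
test-and-sets in their current `Get`. -/
noncomputable def pastSet (input : Fin n → List Op) (s : Config n) (a b : ℕ) : Finset (Fin n) :=
  Finset.univ.filter (Past input s a b)

theorem mem_pastSet {input : Fin n → List Op} {s : Config n} {a b : ℕ} {q : Fin n} :
    q ∈ pastSet input s a b ↔ Past input s a b q := by
  simp [pastSet]

/-- A participant gets past `(a, b)` only by losing its test-and-set number `b`, if no earlier
test-and-set is at a location from `a` on. -/
theorem Move.past {c : ℕ → ℕ} {input : Fin n → List Op} {q : Fin n} {s s' : Config n}
    (h : WellFormed input s) (hm : Move c input q s s') {a b : ℕ} (hb : 0 < b)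
    (hab : ∀ f < b, ∀ x ∈ (probe n c f).support, x < a) {q' : Fin n}
    (hq' : Past input s' a b q') :
    Past input s a b q' ∨ q' = q ∧ (input q)[s.pc q]? = some Op.get ∧
      s.cost q (s.pc q) + 1 = b ∧ s.held q = none ∧ s'.held q = none ∧
      ∃ x ∈ (probe n c (s.cost q (s.pc q))).support, s.mem x = true := by
  by_cases hq : q' = q
  swap
  · obtain ⟨h1, h2, h3⟩ := hm.frame hq
    rw [Past, h1, h2, h3] at hq'
    exact Or.inl hq'
  subst hq
  cases hm with
  | idle hop heq => exact Or.inl (heq ▸ hq')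
  | lose hop x hx hm hmem hpc hheld hcost =>
    have hn := h.held_eq_none hop
    rw [Past, hheld, hpc, hn, hcost.cost_self] at hq'
    by_cases hbc : b ≤ s.cost q' (s.pc q')
    · left
      rw [Past, hn]
      exact ⟨hop, hbc⟩
    · exact Or.inr ⟨rfl, hop, by have := hq'.2; omega, hn, by rw [hheld, hn], x, hx, hm⟩
  | win hop x hx hm hmem hpc hheld hcost =>
    left
    rw [Past, hheld, Function.update_self] at hq'
    rw [Past, h.held_eq_none hop]
    refine ⟨hop, ?_⟩
    by_contra hf
    have := hab _ (not_le.1 hf) x hx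
    simp only at hq'
    omega
  | release hop x hx hmem hpc hheld hcost =>
    rw [Past, hheld, Function.update_self, hpc, Function.update_self,
      hcost.cost_succ_pc h le_rfl] at hq'
    have := hq'.2
    omega
  | read hop hlt hmem hpc hheld hcost =>
    rw [Past, hheld, hpc] at hq'
    left
    rw [Past]
    split at hq'
    · rename_i x hx
      simpa only [hx] using hq'
    · simp [hop] at hq'
  | pass hop hmem hpc hheld hcost =>
    rw [Past, hheld, hpc, Function.update_self, hcost.cost_succ_pc h le_rfl] at hq'
    left
    rw [Past]
    split at hq'
    · rename_i x hx
      simpa only [hx] using hq'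
    · have := hq'.2
      omega

/-- A scan of the backup array ends before the array does: at most `n - x` participants are at
position `x` of the backup array or beyond. -/
def BackupBound (c : ℕ → ℕ) (input : Fin n → List Op) (s : Config n) : Prop :=
  ∀ x, (pastSet input s (2 * n + x) ((trials n c).length + x)).card ≤ n - x

theorem Past.anti {input : Fin n → List Op} {s : Config n} {a a' b b' : ℕ} {q : Fin n}
    (h : Past input s a' b' q) (ha : a ≤ a') (hb : b ≤ b') : Past input s a b q := by
  unfold Past at h ⊢
  rcases hx : s.held q with _ | x <;> simp only [hx] at h ⊢
  · exact ⟨h.1, hb.trans h.2⟩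
  · exact ha.trans h

theorem backupBound_init (c : ℕ → ℕ) (input : Fin n → List Op) (hc : 0 < (trials n c).length) :
    BackupBound c input (Config.init n) := by
  intro x
  have : pastSet input (Config.init n) (2 * n + x) ((trials n c).length + x) = ∅ := by
    ext q
    simp [mem_pastSet, Past, Config.init]
    intro _ h
    simp [h] at hc
  simp [this]

/-- A newcomer at position `x > 0` has just lost at location `2n + x - 1`. Both the newcomer and the
holder of that location are counted at position `x - 1` but not at `x` before the step. Hence the
count at `x` was at least two below the count at `x - 1`, which leaves room for the newcomer. -/
theorem Move.backupBound {c : ℕ → ℕ} {input : Fin n → List Op} {q : Fin n} {s s' : Config n}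
    (h : WellFormed input s) (hB : BackupBound c input s) (hm : Move c input q s s') :
    BackupBound c input s' := by
  classical
  intro x
  rcases Nat.eq_zero_or_pos x with rfl | hx
  · exact (Finset.card_le_univ _).trans (by simp)
  have hab : ∀ f < (trials n c).length + x, ∀ y ∈ (probe n c f).support, y < 2 * n + x :=
    fun f hf y hy => lt_of_mem_support_probe_backup hf hy
  have hpast := fun q' => hm.past h (a := 2 * n + x) (b := (trials n c).length + x)
    (by omega) hab (q' := q')
  by_cases hsub : pastSet input s' (2 * n + x) ((trials n c).length + x) ⊆
      pastSet input s (2 * n + x) ((trials n c).length + x)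
  · exact (Finset.card_le_card hsub).trans (hB x)
  obtain ⟨q', h1, h2⟩ := Finset.not_subset.1 hsub
  rw [mem_pastSet] at h1 h2
  obtain ⟨rfl, hop, hcost, hn, -, y, hy, hmy⟩ := (hpast q' h1).resolve_left h2
  rw [probe_of_backup (by omega), PMF.support_pure, Set.mem_singleton_iff] at hy
  obtain ⟨r, hr⟩ := (h.mem_iff y).1 hmy
  have hrq : r ≠ q' := by
    rintro rfl
    simp [hn] at hr
  have hq'mem : Past input s (2 * n + (x - 1)) ((trials n c).length + (x - 1)) q' := by
    rw [Past, hn]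
    exact ⟨hop, by omega⟩
  have hr1 : Past input s (2 * n + (x - 1)) ((trials n c).length + (x - 1)) r := by
    rw [Past, hr]
    simp only
    omega
  have hr2 : ¬ Past input s (2 * n + x) ((trials n c).length + x) r := by
    rw [Past, hr]
    simp only
    omega
  have hs1 : insert r (insert q' (pastSet input s (2 * n + x) ((trials n c).length + x))) ⊆
      pastSet input s (2 * n + (x - 1)) ((trials n c).length + (x - 1)) := by
    intro p hp
    simp only [Finset.mem_insert] at hp
    rcases hp with rfl | rfl | hp
    · exact mem_pastSet.2 hr1
    · exact mem_pastSet.2 hq'mem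
    · exact mem_pastSet.2 ((mem_pastSet.1 hp).anti (by omega) (by omega))
  have hs2 : pastSet input s' (2 * n + x) ((trials n c).length + x) ⊆
      insert q' (pastSet input s (2 * n + x) ((trials n c).length + x)) := by
    intro p hp
    rw [Finset.mem_insert]
    rcases hpast p (mem_pastSet.1 hp) with h' | h'
    · exact Or.inr (mem_pastSet.2 h')
    · exact Or.inl h'.1
  have c1 := Finset.card_le_card hs1
  have c2 := Finset.card_le_card hs2
  rw [Finset.card_insert_of_notMem (by simp [mem_pastSet, hr2, hrq]),
    Finset.card_insert_of_notMem (by simpa [mem_pastSet] using h2)] at c1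
  rw [Finset.card_insert_of_notMem (by simpa [mem_pastSet] using h2)] at c2
  have := hB (x - 1)
  omega

theorem BackupBound.cost_lt {c : ℕ → ℕ} {input : Fin n → List Op} {s : Config n}
    (hB : BackupBound c input s) {q : Fin n} (hop : (input q)[s.pc q]? = some Op.get)
    (hn : s.held q = none) : s.cost q (s.pc q) < (trials n c).length + n := by
  by_contra hlt
  have h1 : q ∈ pastSet input s (2 * n + n) ((trials n c).length + n) := by
    rw [mem_pastSet, Past, hn]
    exact ⟨hop, not_lt.1 hlt⟩
  have h2 := hB n
  have := Finset.card_pos.2 ⟨q, h1⟩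
  omega

/-! ### The times at which a `Get` can take a step -/

/-- The number of steps that `q` takes before time `t`. -/
def Execution.localTime (e : Execution n) (q : Fin n) (t : ℕ) : ℕ :=
  ((Finset.range t).filter fun u => e.schedule u = q).card

theorem Execution.localTime_succ_self (e : Execution n) (t : ℕ) :
    e.localTime (e.schedule t) (t + 1) = e.localTime (e.schedule t) t + 1 := by
  rw [localTime, Finset.range_add_one, Finset.filter_insert, if_pos rfl,
    Finset.card_insert_of_notMem (by simp)]
  rfl

theorem Execution.localTime_succ_of_ne (e : Execution n) {q : Fin n} {t : ℕ}
    (h : q ≠ e.schedule t) : e.localTime q (t + 1) = e.localTime q t := by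
  rw [localTime, Finset.range_add_one, Finset.filter_insert, if_neg h.symm]
  rfl

theorem Execution.localTime_mono (e : Execution n) (q : Fin n) : Monotone (e.localTime q) :=
  fun _ _ h => Finset.card_le_card (Finset.filter_subset_filter _ (Finset.range_mono h))

theorem Execution.localTime_le (e : Execution n) (q : Fin n) (t : ℕ) : e.localTime q t ≤ t :=
  (Finset.card_filter_le _ _).trans (Finset.card_range t).le

theorem Execution.eq_of_localTime_eq (e : Execution n) {t u : ℕ} (hs : e.schedule t = e.schedule u)
    (h : e.localTime (e.schedule t) t = e.localTime (e.schedule t) u) : t = u := by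
  have key : ∀ {t u}, e.schedule t = e.schedule u →
      e.localTime (e.schedule t) t = e.localTime (e.schedule t) u → ¬ t < u := by
    intro t u _ h htu
    have h1 := e.localTime_mono (e.schedule t) (Nat.succ_le_of_lt htu)
    rw [Nat.succ_eq_add_one, e.localTime_succ_self] at h1
    omega
  exact le_antisymm (not_lt.1 (key hs.symm (by rw [← hs]; exact h.symm))) (not_lt.1 (key hs h))

/-- The number of steps of an operation other than a `Get`. -/
def fixedCost (n : ℕ) : Op → ℕ
  | Op.collect => 3 * n
  | _ => 1

/-- What holds in every configuration that can be reached at time `t`. -/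
structure Reachable (e : Execution n) (c : ℕ → ℕ) (t : ℕ) (s : Config n) : Prop where
  wellFormed : WellFormed e.input s
  backupBound : BackupBound c e.input s
  get_cost : ∀ q k, e.IsGet q k → s.cost q k ≤ (trials n c).length + n
  done_cost : ∀ q, ∀ k < s.pc q, ∀ op, (e.input q)[k]? = some op → op ≠ Op.get →
    s.cost q k = fixedCost n op
  time : ∀ q, s.pc q < (e.input q).length →
    ∑ k ∈ Finset.range (s.pc q + 1), s.cost q k = e.localTime q t

theorem reachable_init (e : Execution n) (c : ℕ → ℕ) (hc : 0 < (trials n c).length) :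
    Reachable e c 0 (Config.init n) where
  wellFormed := wellFormed_init e.wellFormed
  backupBound := backupBound_init c _ hc
  get_cost _ _ _ := Nat.zero_le _
  done_cost q k hk := absurd hk (Nat.not_lt_zero k)
  time q _ := by simp [Config.init, Execution.localTime]

/-- In a step, either `q` has completed its input, or its current operation goes on, or it
completes this operation. -/
theorem Move.pc {c : ℕ → ℕ} {input : Fin n → List Op} {q : Fin n} {s s' : Config n}
    (hm : Move c input q s s') :
    ((input q)[s.pc q]? = none ∧ s' = s) ∨
      (∃ op, (input q)[s.pc q]? = some op ∧ Spends q s s' ∧ s'.pc q = s.pc q) ∨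
      ∃ op, (input q)[s.pc q]? = some op ∧ Spends q s s' ∧ s'.pc q = s.pc q + 1 ∧
        (op = Op.collect → s.cost q (s.pc q) + 1 = 3 * n) := by
  cases hm with
  | idle hop heq => exact Or.inl ⟨hop, heq⟩
  | lose hop x hx hm hmem hpc hheld hcost => exact Or.inr (Or.inl ⟨_, hop, hcost, by rw [hpc]⟩)
  | win hop x hx hm hmem hpc hheld hcost =>
    exact Or.inr (Or.inr ⟨_, hop, hcost, by rw [hpc, Function.update_self], by simp⟩)
  | release hop x hx hmem hpc hheld hcost =>
    exact Or.inr (Or.inr ⟨_, hop, hcost, by rw [hpc, Function.update_self], by simp⟩)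
  | read hop hlt hmem hpc hheld hcost => exact Or.inr (Or.inl ⟨_, hop, hcost, by rw [hpc]⟩)
  | pass hop hmem hpc hheld hcost =>
    rcases hop with hop | ⟨hop, h⟩
    · exact Or.inr (Or.inr ⟨_, hop, hcost, by rw [hpc, Function.update_self], by simp⟩)
    · exact Or.inr (Or.inr ⟨_, hop, hcost, by rw [hpc, Function.update_self], fun _ => h⟩)

theorem Spends.sum_cost {q : Fin n} {s s' : Config n} (h : Spends q s s') :
    ∑ k ∈ Finset.range (s.pc q + 1), s'.cost q k =
      ∑ k ∈ Finset.range (s.pc q + 1), s.cost q k + 1 := by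
  rw [Finset.sum_range_succ, Finset.sum_range_succ, h.cost_self, ← add_assoc]
  congr 2
  exact Finset.sum_congr rfl fun k hk => h.cost_self_of_ne (Finset.mem_range.1 hk).ne

/-- Only a `Get` that takes a step changes the cost of a `Get`. -/
theorem Move.get_cost {c : ℕ → ℕ} {input : Fin n → List Op} {q : Fin n} {s s' : Config n}
    (hm : Move c input q s s') {q' : Fin n} {k : ℕ} (hk : (input q')[k]? = some Op.get) :
    s'.cost q' k = s.cost q' k ∨ q' = q ∧ k = s.pc q ∧ s'.cost q' k = s.cost q' k + 1 := by
  by_cases hq : q' = q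
  swap
  · left
    rw [(hm.frame hq).2.2]
  subst hq
  have key : Spends q' s s' →
      s'.cost q' k = s.cost q' k ∨ q' = q' ∧ k = s.pc q' ∧ s'.cost q' k = s.cost q' k + 1 := by
    intro h
    by_cases hkp : k = s.pc q'
    · subst hkp
      exact Or.inr ⟨rfl, rfl, h.cost_self⟩
    · exact Or.inl (h.cost_self_of_ne hkp)
  rcases hm.pc with ⟨_, rfl⟩ | ⟨_, _, h, _⟩ | ⟨_, _, h, _⟩
  · exact Or.inl rfl
  · exact key h
  · exact key h

theorem Move.reachable {e : Execution n} {c : ℕ → ℕ} {t : ℕ} {s s' : Config n}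
    (h : Reachable e c t s) (hm : Move c e.input (e.schedule t) s s') :
    Reachable e c (t + 1) s' where
  wellFormed := hm.wellFormed h.wellFormed
  backupBound := hm.backupBound h.wellFormed h.backupBound
  get_cost q k hk := by
    rcases hm.get_cost hk with h1 | ⟨rfl, rfl, h1⟩
    · rw [h1]
      exact h.get_cost q k hk
    · rw [h1]
      exact h.backupBound.cost_lt hk (h.wellFormed.held_eq_none hk)
  done_cost q k hk op hop hne := by
    by_cases hq : q = e.schedule t
    swap
    · obtain ⟨h1, h2, h3⟩ := hm.frame hq
      rw [h1] at hk
      rw [h3]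
      exact h.done_cost q k hk op hop hne
    subst hq
    rcases hm.pc with ⟨_, rfl⟩ | ⟨op', hop', hs, hpc⟩ | ⟨op', hop', hs, hpc, hcol⟩
    · exact h.done_cost _ k hk op hop hne
    · rw [hpc] at hk
      rw [hs.cost_self_of_ne hk.ne]
      exact h.done_cost _ k hk op hop hne
    · rw [hpc] at hk
      rcases Nat.lt_succ_iff_lt_or_eq.1 hk with hlt | rfl
      · rw [hs.cost_self_of_ne hlt.ne]
        exact h.done_cost _ k hlt op hop hne
      · rw [hs.cost_self]
        obtain rfl : op' = op := Option.some.inj (hop'.symm.trans hop)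
        by_cases hc : op' = Op.collect
        · rw [hcol hc, hc]
          rfl
        · rw [h.wellFormed.cost_now _ (by simpa [hop] using hne) (by simpa [hop] using hc)]
          cases op' <;> simp_all [fixedCost]
  time q hq' := by
    by_cases hq : q = e.schedule t
    swap
    · obtain ⟨h1, h2, h3⟩ := hm.frame hq
      rw [h1] at hq' ⊢
      rw [h3, e.localTime_succ_of_ne hq]
      exact h.time q hq'
    subst hq
    rw [e.localTime_succ_self]
    rcases hm.pc with ⟨hn, rfl⟩ | ⟨op', hop', hs, hpc⟩ | ⟨op', hop', hs, hpc, hcol⟩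
    · rw [List.getElem?_eq_none_iff] at hn
      omega
    · rw [hpc] at hq' ⊢
      rw [hs.sum_cost, h.time _ hq']
    · rw [hpc] at hq' ⊢
      rw [Finset.sum_range_succ, hs.sum_cost, h.time _ (by omega),
        hs.cost_succ_pc h.wellFormed le_rfl, add_zero]

/-- The law of an execution as that of a Markov chain. -/
theorem Execution.law_eq_chain (e : Execution n) (c : ℕ → ℕ) (t : ℕ) :
    e.law c t = chain (Config.init n) (fun t => Config.step c e.input (e.schedule t)) t := by
  induction t with
  | zero => rfl
  | succ t ih => rw [law, chain, ih]

theorem Reachable.step {e : Execution n} {c : ℕ → ℕ} {t : ℕ} {s : Config n}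
    (h : Reachable e c t s) :
    ∀ s' ∈ (Config.step c e.input (e.schedule t) s).support, Reachable e c (t + 1) s' :=
  fun _ hs' => (move_of_mem_support h.wellFormed hs').reachable h

/-- At time `t` some reachable configuration has the scheduled participant in a `Get`. -/
def Execution.GetTime (e : Execution n) (c : ℕ → ℕ) (t : ℕ) : Prop :=
  ∃ s, Reachable e c t s ∧ e.IsGet (e.schedule t) (s.pc (e.schedule t))

theorem card_filter_getElem? {β : Type*} [DecidableEq β] (l : List β) (a : β) :
    ((Finset.range l.length).filter fun k => l[k]? = some a).card = l.count a := by
  induction l with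
  | nil => simp
  | cons b l ih =>
    rw [List.length_cons, Finset.range_eq_Ico,
      ← Finset.insert_Ico_add_one_left_eq_Ico (Nat.succ_pos _), Finset.filter_insert]
    have h1 : ((Finset.Ico (0 + 1) (l.length + 1)).filter fun k => (b :: l)[k]? = some a) =
        ((Finset.range l.length).filter fun k => l[k]? = some a).map (addRightEmbedding 1) := by
      rw [Finset.range_eq_Ico, ← Finset.map_add_right_Ico, Finset.filter_map]
      congr 1
    rw [h1, List.count_cons]
    simp only [List.getElem?_cons_zero, Option.some.injEq, beq_iff_eq]
    split_ifs with h
    · rw [Finset.card_insert_of_notMem (by simp), Finset.card_map, ih]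
    · rw [Finset.card_map, ih]; rfl

open Classical in
/-- There are few times at which a `Get` can take a step, since the time is determined by the
participant, the position in its input, and the number of steps of its `Get` operations so far. -/
theorem Execution.card_getTime_le (e : Execution n) (c : ℕ → ℕ) (T : ℕ) :
    ((Finset.range T).filter (e.GetTime c)).card ≤
      e.numGetFree * (e.numGetFree * ((trials n c).length + n) + 1) := by
  set B := (trials n c).length + n with hB
  let pos : Fin n → Finset ℕ := fun q =>
    (Finset.range (e.input q).length).filter fun k => (e.input q)[k]? = some Op.get
  have hpos : ∀ q, (pos q).card = (e.input q).count Op.get := fun q => card_filter_getElem? _ _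
  let M := e.numGetFree
  have hM : ∑ q, (pos q).card ≤ M := by
    refine Finset.sum_le_sum fun q _ => ?_
    rw [hpos]
    exact Nat.le_add_right _ _
  have hle : ∀ q, (pos q).card ≤ M := fun q =>
    (Finset.single_le_sum (f := fun q => (pos q).card) (fun _ _ => Nat.zero_le _)
      (Finset.mem_univ q)).trans hM
  let target : Finset (Σ _ : Fin n, ℕ × ℕ) :=
    Finset.univ.sigma fun q => pos q ×ˢ Finset.range (M * B + 1)
  have hcard : target.card ≤ M * (M * B + 1) := by
    rw [Finset.card_sigma]
    simp only [Finset.card_product, Finset.card_range, ← Finset.sum_mul]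
    exact Nat.mul_le_mul_right _ hM
  -- One reachable witness is chosen for each time. Witnesses of different times may come from
  -- incompatible random choices; only the counts below are compared.
  have hex : ∀ t, ∃ s, e.GetTime c t →
      Reachable e c t s ∧ e.IsGet (e.schedule t) (s.pc (e.schedule t)) := by
    intro t
    by_cases ht : e.GetTime c t
    · obtain ⟨s, hs⟩ := ht
      exact ⟨s, fun _ => hs⟩
    · exact ⟨Config.init n, fun h => absurd h ht⟩
  choose σ hσ using hex
  -- The completed operations other than `Get` have fixed costs. Hence the participant, its position
  -- and this sum determine its local time, and with it `t`.
  let getCost : ℕ → ℕ := fun t =>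
    ∑ k ∈ (Finset.range ((σ t).pc (e.schedule t) + 1)).filter
      (fun k => (e.input (e.schedule t))[k]? = some Op.get), (σ t).cost (e.schedule t) k
  refine (Finset.card_le_card_of_injOn (t := target)
    (fun t => ⟨e.schedule t, (σ t).pc (e.schedule t), getCost t⟩) ?_ ?_).trans hcard
  · intro t ht
    obtain ⟨hr, hg⟩ := hσ t (Finset.mem_filter.1 ht).2
    have hlen := (List.getElem?_eq_some_iff.1 hg).1
    simp only [target, Finset.coe_sigma, Set.mem_sigma_iff, Finset.mem_coe, Finset.mem_univ,
      Finset.mem_product, Finset.mem_range, true_and, pos, Finset.mem_filter]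
    refine ⟨⟨hlen, hg⟩, Nat.lt_succ_of_le ?_⟩
    calc getCost t ≤ ∑ k ∈ pos (e.schedule t), (σ t).cost (e.schedule t) k := by
          refine Finset.sum_le_sum_of_subset fun k hk => ?_
          rw [Finset.mem_filter, Finset.mem_range] at hk ⊢
          exact ⟨by omega, hk.2⟩
      _ ≤ (pos (e.schedule t)).card * B := by
          rw [← smul_eq_mul]
          exact Finset.sum_le_card_nsmul _ _ _ fun k hk =>
            hr.get_cost _ _ (Finset.mem_filter.1 hk).2
      _ ≤ M * B := Nat.mul_le_mul_right _ (hle _)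
  · intro t ht u hu htu
    obtain ⟨hr, hg⟩ := hσ t (Finset.mem_filter.1 ht).2
    obtain ⟨hr', hg'⟩ := hσ u (Finset.mem_filter.1 hu).2
    simp only [Sigma.mk.injEq, heq_eq_eq, Prod.mk.injEq] at htu
    obtain ⟨hq, hp, hc⟩ := htu
    refine e.eq_of_localTime_eq hq ?_
    have h1 := hr.time _ (List.getElem?_eq_some_iff.1 hg).1
    have h2 := hr'.time _ (List.getElem?_eq_some_iff.1 hg').1
    rw [← h1, hq, ← h2]
    rw [← Finset.sum_filter_add_sum_filter_not _
        (fun k => (e.input (e.schedule u))[k]? = some Op.get),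
      ← Finset.sum_filter_add_sum_filter_not (Finset.range ((σ u).pc (e.schedule u) + 1))
        (fun k => (e.input (e.schedule u))[k]? = some Op.get)]
    simp only [getCost, hq] at hc
    rw [hq] at hp
    rw [hc, hp]
    congr 1
    refine Finset.sum_congr rfl fun k hk => ?_
    rw [Finset.mem_filter, Finset.mem_range] at hk
    have hlen := (List.getElem?_eq_some_iff.1 hg').1
    have hkne : k ≠ (σ u).pc (e.schedule u) := fun h => hk.2 (h ▸ hg')
    obtain ⟨op, hop⟩ : ∃ op, (e.input (e.schedule u))[k]? = some op :=
      ⟨_, List.getElem?_eq_getElem (by omega)⟩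
    have hne := hk.2
    rw [hop, Option.some.injEq] at hne
    rw [hr'.done_cost _ k (by omega) _ hop hne, ← hq,
      hr.done_cost _ k (by rw [hq]; omega) _ (by rw [hq]; exact hop) hne]

/-! ### The probability that a trial fails -/

theorem mean_uniformOfFinset (A : Finset ℕ) (hA : A.Nonempty) (p : ℕ → Prop) [DecidablePred p] :
    mean (PMF.uniformOfFinset A hA) (fun x => if p x then 1 else 0) =
      ((A.filter p).card : ℝ≥0∞) / (A.card : ℝ≥0∞) := by
  have h : ∀ x, PMF.uniformOfFinset A hA x * (if p x then 1 else 0) =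
      if x ∈ A.filter p then (A.card : ℝ≥0∞)⁻¹ else 0 := by
    intro x
    rw [PMF.uniformOfFinset_apply]
    by_cases h1 : x ∈ A <;> by_cases h2 : p x <;> simp [h1, h2, Finset.mem_filter]
  rw [mean, tsum_congr h, tsum_eq_sum (s := A.filter p) (fun x hx => if_neg hx),
    Finset.sum_congr rfl (fun x hx => if_pos hx), Finset.sum_const, nsmul_eq_mul, div_eq_mul_inv]

/-- The probability that the test-and-set that follows `f` unsuccessful ones fails. -/
noncomputable def failProb (c : ℕ → ℕ) (s : Config n) (f : ℕ) : ℝ≥0∞ :=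
  mean (probe n c f) (fun x => if s.mem x then 1 else 0)

/-- Occupied locations have holders, distinct for distinct locations, and a holder in batch `i`
counts as past it whatever `b` is. -/
theorem WellFormed.card_occupied_le {input : Fin n → List Op} {s : Config n}
    (h : WellFormed input s) (i b : ℕ) :
    ((batch n i).filter fun x => s.mem x = true).card ≤
      (pastSet input s (batchStart n i) b).card := by
  refine (Finset.card_le_card (t := (pastSet input s (batchStart n i) b).image
    fun q => (s.held q).getD 0) fun x hx => ?_).trans Finset.card_image_le
  rw [Finset.mem_filter, mem_batch] at hx
  obtain ⟨q, hq⟩ := (h.mem_iff x).1 hx.2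
  refine Finset.mem_image.2 ⟨q, mem_pastSet.2 ?_, by rw [hq]; rfl⟩
  rw [Past, hq]
  exact hx.1.1

theorem WellFormed.failProb_le {input : Fin n → List Op} {s : Config n}
    (h : WellFormed input s) {c : ℕ → ℕ} {i f : ℕ} (hi : i < Nat.log 2 n)
    (h1 : trialStart c i ≤ f) (h2 : f < trialStart c (i + 1)) (b : ℕ) :
    failProb c s f ≤
      ((pastSet input s (batchStart n i) b).card : ℝ≥0∞) / (batchSize n i : ℝ≥0∞) := by
  rw [failProb, probe_of_trial hi h1 h2]
  rw [mean_uniformOfFinset (batch n i) (batch_nonempty hi) (fun x => s.mem x = true), card_batch]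
  gcongr
  exact h.card_occupied_le i b

/-! ### The potential of a participant -/

/-- The number of steps after which a participant that holds an index and has the operations `l`
before it has freed the index, or `τ` if it does not free it. -/
def holdTime (n τ : ℕ) : List Op → ℕ
  | Op.free :: _ => 1
  | Op.collect :: l => 3 * n + holdTime n τ l
  | Op.call :: l => 1 + holdTime n τ l
  | _ => τ

/-- The parameters of the potential: it bounds the probability that, at a given later time, a
participant is past `(a, b)`, if every trial fails with probability at most `θ`, and each of the `w`
trials before trial number `b` with probability at most `θ * η`. -/
structure Level where
  θ : ℝ≥0
  η : ℝ≥0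
  a : ℕ
  b : ℕ
  w : ℕ
  w_le : w ≤ b

namespace Level

variable (P : Level)

/-- The contribution to the potential of the `Get` operations that start later. -/
noncomputable def geom (m : ℕ) : ℝ≥0 := ∑ j ∈ Finset.range m, P.η ^ P.w * P.θ ^ j

/-- The contribution to the potential of a current `Get` with `f` failures. -/
noncomputable def weight (m f : ℕ) : ℝ≥0 := P.θ ^ (m - f) * P.η ^ min P.w (P.b - f)

/-- The potential of a participant with `r` steps to go that has the operations `l` before it and
has performed `f` steps of the first one. -/
noncomputable def localPot (n τ : ℕ) : List Op → ℕ → Option ℕ → ℕ → ℝ≥0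
  | l, f, some x, r =>
    if r < holdTime n τ l - f then (if P.a ≤ x then 1 else 0)
    else P.geom (r - (holdTime n τ l - f) + 1)
  -- The `Get` started with `r + f` steps to go. A win after `j` losses leaves `r + f - j - 1`
  -- steps, so the index is still held at the target time exactly if `j ≥ m`, where `m = r + f -
  -- holdTime n τ l`. After an earlier win, only later `Get` operations count, and `geom m` covers
  -- them.
  | Op.get :: l, f, none, r =>
    P.geom (r + f - holdTime n τ l) + P.weight (r + f - holdTime n τ l) f
  | _, _, none, r => P.geom (r + 1)

/-- The potential of participant `q` with `r` steps to go. -/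
noncomputable def pot (τ : ℕ) (input : Fin n → List Op) (s : Config n) (q : Fin n) (r : ℕ) :
    ℝ≥0 :=
  P.localPot n τ ((input q).drop (s.pc q)) (s.cost q (s.pc q)) (s.held q) r

theorem geom_mono : Monotone P.geom := fun _ _ h =>
  Finset.sum_le_sum_of_subset (Finset.range_mono h)

theorem geom_succ (m : ℕ) : P.geom (m + 1) = P.geom m + P.η ^ P.w * P.θ ^ m :=
  Finset.sum_range_succ _ _

theorem localPot_none_of_ne {τ : ℕ} {l : List Op} (h : l.head? ≠ some Op.get) (f r : ℕ) :
    P.localPot n τ l f none r = P.geom (r + 1) := by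
  match l with
  | [] => rfl
  | Op.get :: l => exact absurd rfl h
  | Op.free :: l => rfl
  | Op.collect :: l => rfl
  | Op.call :: l => rfl

/-- The weight of a fresh `Get` is exactly the next term of the geometric series. -/
theorem localPot_start_le (τ : ℕ) (l : List Op) (r : ℕ) :
    P.localPot n τ l 0 none r ≤ P.geom (r + 1) := by
  by_cases h : l.head? = some Op.get
  · match l, h with
    | Op.get :: l, _ =>
      have h1 : P.weight (r + 0 - holdTime n τ l) 0 =
          P.η ^ P.w * P.θ ^ (r + 0 - holdTime n τ l) := by
        rw [weight, mul_comm, Nat.sub_zero, Nat.sub_zero, min_eq_left P.w_le]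
      rw [localPot, h1, ← geom_succ]
      exact P.geom_mono (by omega)
  · rw [P.localPot_none_of_ne h]

theorem localPot_some (τ : ℕ) (l : List Op) (f x r : ℕ) :
    P.localPot n τ l f (some x) r =
      if r < holdTime n τ l - f then (if P.a ≤ x then 1 else 0)
      else P.geom (r - (holdTime n τ l - f) + 1) := by
  rw [localPot]

/-- The potential of a participant that holds an index depends only on the number of steps to go
and the number of steps until the index is free. -/
theorem localPot_some_eq {τ : ℕ} {l l' : List Op} {f f' r : ℕ} (x : ℕ)
    (h : holdTime n τ l - f = holdTime n τ l' - f' + 1) :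
    P.localPot n τ l f (some x) (r + 1) = P.localPot n τ l' f' (some x) r := by
  rw [localPot_some, localPot_some, h]
  simp only [Nat.add_lt_add_iff_right, Nat.add_sub_add_right]

variable {P}
variable {c : ℕ → ℕ} {input : Fin n → List Op} {q : Fin n} {s s' : Config n} {τ r : ℕ}

/-- Outside a `Get`, the time to go and the remaining holding time fall together, and `geom` is
monotone. The bound on `τ` matters for a participant that ends its input with an index: its holding
time never runs out. -/
theorem pot_step_of_ne_get (h : WellFormed input s) (hm : Move c input q s s')
    (hop : (input q)[s.pc q]? ≠ some Op.get) (hτ : r + 1 < τ) :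
    P.pot τ input s' q r ≤ P.pot τ input s q (r + 1) := by
  have hhead : ((input q).drop (s.pc q)).head? ≠ some Op.get := by rwa [List.head?_drop]
  unfold pot
  cases hm with
  | idle hop' heq =>
    rw [heq]
    rcases hx : s.held q with _ | x
    · rw [P.localPot_none_of_ne hhead, P.localPot_none_of_ne hhead]
      exact P.geom_mono (by omega)
    · have hnil : (input q).drop (s.pc q) = [] := by
        rw [List.drop_eq_nil_iff]
        exact List.getElem?_eq_none_iff.1 hop'
      have hf := h.cost_now q hop (by simp [hop'])
      have hτ' : holdTime n τ [] = τ := rfl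
      rw [hnil, hf, localPot_some, localPot_some, hτ', Nat.sub_zero, if_pos (by omega : r < τ),
        if_pos hτ]
  | lose hop' => exact absurd hop' hop
  | win hop' => exact absurd hop' hop
  | release hop' x hx hmem hpc hheld hcost =>
    have hf := h.cost_now q hop (by simp [hop'])
    rw [hheld, hpc, Function.update_self, Function.update_self, hcost.cost_succ_pc h le_rfl,
      drop_of_getElem? hop', hx, hf, localPot_some, holdTime, if_neg (by omega)]
    exact (P.localPot_start_le _ _ _).trans (P.geom_mono (by omega))
  | read hop' hlt hmem hpc hheld hcost =>
    rw [hheld, hpc, hcost.cost_self]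
    rcases hx : s.held q with _ | x
    · rw [P.localPot_none_of_ne hhead, P.localPot_none_of_ne hhead]
      exact P.geom_mono (by omega)
    · refine (P.localPot_some_eq x ?_).ge
      have := h.cost_collect q hop'
      rw [drop_of_getElem? hop', holdTime]
      omega
  | pass hop' hmem hpc hheld hcost =>
    rw [hheld, hpc, Function.update_self, hcost.cost_succ_pc h le_rfl]
    rcases hx : s.held q with _ | x
    · rw [P.localPot_none_of_ne hhead]
      exact (P.localPot_start_le _ _ _).trans (P.geom_mono (by omega))
    · refine (P.localPot_some_eq x ?_).ge
      rcases hop' with hop' | ⟨hop', hc⟩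
      · have hf := h.cost_now q hop (by simp [hop'])
        rw [drop_of_getElem? hop', holdTime, hf]
        omega
      · rw [drop_of_getElem? hop', holdTime]
        omega

theorem mean_step_of_ne_get (h : WellFormed input s)
    (hop : (input q)[s.pc q]? ≠ some Op.get) (hτ : r + 1 < τ) :
    mean (Config.step c input q s) (fun s' => P.pot τ input s' q r) ≤
      P.pot τ input s q (r + 1) :=
  mean_le_of_support fun _ hs' =>
    ENNReal.coe_le_coe.2 (pot_step_of_ne_get h (move_of_mem_support h hs') hop hτ)

/-- A further loss may use up one factor `θ` (if `f < m`) and one factor `η` (if `f` is among the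
last `w` trials before `b`). The failure probability `p` pays for whichever factors are used up. -/
theorem mul_weight_le {p : ℝ≥0∞} {m f : ℕ} (hθ : p ≤ P.θ)
    (hη : P.b ≤ f + P.w → f < P.b → p ≤ P.θ * P.η) (hθ1 : P.θ ≤ 1) (hη1 : P.η ≤ 1) :
    p * P.weight m (f + 1) ≤ P.weight m f := by
  have h1 : (P.θ : ℝ≥0∞) * (P.θ ^ (m - (f + 1)) : ℝ≥0) ≤ (P.θ ^ (m - f) : ℝ≥0) := by
    rw [← ENNReal.coe_mul, ENNReal.coe_le_coe, ← pow_succ']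
    exact pow_le_pow_of_le_one zero_le hθ1 (by omega)
  rw [weight, weight, ENNReal.coe_mul, ENNReal.coe_mul, ← mul_assoc]
  by_cases h : P.b ≤ f + P.w ∧ f < P.b
  · calc p * (P.θ ^ (m - (f + 1)) : ℝ≥0) * (P.η ^ min P.w (P.b - (f + 1)) : ℝ≥0)
        ≤ (P.θ * P.η) * (P.θ ^ (m - (f + 1)) : ℝ≥0) * (P.η ^ min P.w (P.b - (f + 1)) : ℝ≥0) := by
          gcongr
          exact hη h.1 h.2
      _ = (P.θ * (P.θ ^ (m - (f + 1)) : ℝ≥0)) *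
          ((P.η * P.η ^ min P.w (P.b - (f + 1)) : ℝ≥0) : ℝ≥0∞) := by
          rw [ENNReal.coe_mul]; ring
      _ ≤ _ := by
          gcongr
          rw [← pow_succ']
          exact pow_le_pow_of_le_one zero_le hη1 (by omega)
  · by_cases hm : f < m
    · calc p * (P.θ ^ (m - (f + 1)) : ℝ≥0) * (P.η ^ min P.w (P.b - (f + 1)) : ℝ≥0)
          ≤ P.θ * (P.θ ^ (m - (f + 1)) : ℝ≥0) * (P.η ^ min P.w (P.b - f) : ℝ≥0) := by
            refine mul_le_mul' (mul_le_mul' hθ le_rfl) (ENNReal.coe_le_coe.2 ?_)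
            exact pow_le_pow_of_le_one zero_le hη1 (by omega)
      _ ≤ _ := by gcongr
    · have hp : p ≤ 1 := hθ.trans (by exact_mod_cast hθ1)
      have e1 : m - (f + 1) = 0 := by omega
      have e2 : m - f = 0 := by omega
      have e3 : min P.w (P.b - (f + 1)) = min P.w (P.b - f) := by omega
      rw [e1, e2, e3]
      simpa using mul_le_of_le_one_left' hp

theorem pot_lose (hop : (input q)[s.pc q]? = some Op.get) (hn : s.held q = none)
    {x : ℕ} (hx : s.mem x = true) :
    P.pot τ input (s.testAndSet q x) q r =
      P.geom (r + 1 + s.cost q (s.pc q) - holdTime n τ ((input q).drop (s.pc q + 1))) +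
      P.weight (r + 1 + s.cost q (s.pc q) - holdTime n τ ((input q).drop (s.pc q + 1)))
        (s.cost q (s.pc q) + 1) := by
  rw [Config.testAndSet, if_pos hx, pot]
  simp only [Config.tick, Function.update_self, hn]
  rw [drop_of_getElem? hop, localPot]
  congr 2 <;> omega

/-- Either the index is freed by the target time, and only later `Get` operations matter, or it is
still held, and only its location matters. -/
theorem pot_win (h : WellFormed input s) {x : ℕ} (hx : s.mem x = false) :
    P.pot τ input (s.testAndSet q x) q r ≤
      P.geom (r + 1 + s.cost q (s.pc q) - holdTime n τ ((input q).drop (s.pc q + 1))) +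
      if P.a ≤ x ∧ r + 1 + s.cost q (s.pc q) - holdTime n τ ((input q).drop (s.pc q + 1)) ≤
        s.cost q (s.pc q) then 1 else 0 := by
  rw [Config.testAndSet, if_neg (by simp [hx]), pot]
  simp only [Config.tick, Config.next, Function.update_self]
  rw [Function.update_of_ne (by omega), h.cost_future q _ (by omega), localPot_some, Nat.sub_zero]
  split_ifs with h1 h2 h3 h3 h3
  · exact le_add_self
  · exfalso
    omega
  · simp
  · simp
  · exact (P.geom_mono (by omega)).trans le_self_add
  · rw [add_zero]
    exact P.geom_mono (by omega)

theorem pot_get (hop : (input q)[s.pc q]? = some Op.get) (hn : s.held q = none) :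
    P.pot τ input s q r =
      P.geom (r + s.cost q (s.pc q) - holdTime n τ ((input q).drop (s.pc q + 1))) +
      P.weight (r + s.cost q (s.pc q) - holdTime n τ ((input q).drop (s.pc q + 1)))
        (s.cost q (s.pc q)) := by
  rw [pot, drop_of_getElem? hop, hn, localPot]

theorem mean_step_of_get (h : WellFormed input s) (hop : (input q)[s.pc q]? = some Op.get)
    (hθ : failProb c s (s.cost q (s.pc q)) ≤ P.θ)
    (hη : P.b ≤ s.cost q (s.pc q) + P.w → s.cost q (s.pc q) < P.b →
      failProb c s (s.cost q (s.pc q)) ≤ P.θ * P.η)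
    (hθ1 : P.θ ≤ 1) (hη1 : P.η ≤ 1)
    (hab : ∀ f < P.b, ∀ x ∈ (probe n c f).support, x < P.a) :
    mean (Config.step c input q s) (fun s' => P.pot τ input s' q r) ≤
      P.pot τ input s q (r + 1) := by
  have hn := h.held_eq_none hop
  have hstep : Config.step c input q s =
      (probe n c (s.cost q (s.pc q))).map fun x => s.testAndSet q x := by
    simp only [Config.step, hop]
  rw [hstep, mean_map, pot_get hop hn]
  set f := s.cost q (s.pc q) with hf
  set m := r + 1 + f - holdTime n τ ((input q).drop (s.pc q + 1)) with hm
  -- In this case a win contributes only `geom m`: either the index is freed in time, or the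
  -- location lies before `a`. In the other case the weight is already `1` and stays `1` after a
  -- loss.
  by_cases hcase : f < m ∨ f < P.b
  · calc mean (probe n c f) (fun x => (P.pot τ input (s.testAndSet q x) q r : ℝ≥0∞))
        ≤ mean (probe n c f) (fun x => (P.geom m : ℝ≥0∞) +
            P.weight m (f + 1) * (if s.mem x then 1 else 0)) := by
          refine mean_mono_of_support fun x hx => ?_
          cases hmx : s.mem x with
          | true =>
            rw [pot_lose hop hn hmx]
            simp [hm, hf]
          | false =>
            refine (ENNReal.coe_le_coe.2 (pot_win h hmx)).trans ?_
            rw [← hf, ← hm, if_neg]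
            · simp
            · rintro ⟨h1, h2⟩
              have := hab f (by omega) x hx
              omega
      _ = P.geom m + P.weight m (f + 1) * failProb c s f := by
          rw [mean_add, mean_const, mean_const_mul, failProb]
      _ ≤ P.geom m + P.weight m f := by
          rw [mul_comm]
          gcongr
          exact mul_weight_le hθ hη hθ1 hη1
      _ = _ := by rw [ENNReal.coe_add]
  · have hw : ∀ f' ≥ f, P.weight m f' = 1 := by
      intro f' hf'
      have e1 : m - f' = 0 := by omega
      have e2 : P.b - f' = 0 := by omega
      rw [weight, e1, e2]
      simp
    refine mean_le_of_support fun x hx => ENNReal.coe_le_coe.2 ?_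
    rw [hw f le_rfl]
    cases hmx : s.mem x with
    | true =>
      rw [pot_lose hop hn hmx, ← hf, ← hm, hw _ (Nat.le_succ f)]
    | false =>
      refine (pot_win h hmx).trans ?_
      rw [← hf, ← hm]
      gcongr
      split_ifs <;> simp

/-- At the target time the potential dominates the indicator that it was built to estimate. -/
theorem one_le_pot_zero (h : WellFormed input s) (hτ : 0 < τ)
    (hp : Past input s P.a P.b q) : 1 ≤ P.pot τ input s q 0 := by
  rcases hx : s.held q with _ | x
  · rw [Past, hx] at hp
    rw [pot_get hp.1 hx]
    refine le_add_left ?_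
    have e1 : 0 + s.cost q (s.pc q) - holdTime n τ ((input q).drop (s.pc q + 1)) -
      s.cost q (s.pc q) = 0 := by omega
    have e2 : P.b - s.cost q (s.pc q) = 0 := by have := hp.2; omega
    rw [weight, e1, e2]
    simp
  · rw [Past, hx] at hp
    have hpos : ∀ l, 0 < holdTime n τ l := by
      have := q.pos
      intro l
      match l with
      | [] => exact hτ
      | Op.get :: l => exact hτ
      | Op.free :: l => exact Nat.one_pos
      | Op.collect :: l => rw [holdTime]; omega
      | Op.call :: l => rw [holdTime]; omega
    rw [pot, hx, localPot_some, if_pos, if_pos hp]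
    rcases hop : (input q)[s.pc q]? with _ | op
    · rw [h.cost_now q (by simp [hop]) (by simp [hop])]
      exact hpos _
    · have hne : op ≠ Op.get := by
        rintro rfl
        rw [h.held_eq_none hop] at hx
        simp at hx
      by_cases hc : op = Op.collect
      · subst hc
        have h1 := h.cost_collect q hop
        rw [drop_of_getElem? hop, holdTime]
        omega
      · rw [h.cost_now q (by simp [hop, hne]) (by simp [hop, hc])]
        exact hpos _

theorem pot_init_le (τ : ℕ) (input : Fin n → List Op) (q : Fin n) (r : ℕ) :
    P.pot τ input (Config.init n) q r ≤ P.geom (r + 1) :=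
  P.localPot_start_le _ _ _

end Level

/-! ### Balanced configurations -/

/-- The first `I` batches are balanced: for `1 ≤ i ≤ I`, at most `μ i` participants have got to
batch `i` or beyond. -/
def balanced (c : ℕ → ℕ) (input : Fin n → List Op) (I : ℕ) (μ : ℕ → ℕ) : Set (Config n) :=
  {s | ∀ i, 1 ≤ i → i ≤ I → (pastSet input s (batchStart n i) (trialStart c i)).card ≤ μ i}

/-- Thresholds `μ` for which every trial in batch `i < I` fails with probability at most
`7 / 8 * η i` in a balanced configuration. -/
structure Thresholds (n : ℕ) (c : ℕ → ℕ) (I : ℕ) (μ : ℕ → ℕ) (η : ℕ → ℝ≥0) : Prop where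
  one_le : 1 ≤ I
  le_log : I ≤ Nat.log 2 n
  last : μ I = 0
  trials_pos : ∀ i, 0 < c i
  η_le_one : ∀ i, η i ≤ 1
  first_batch : (n : ℝ≥0∞) / (batchSize n 0 : ℝ≥0∞) ≤ (7 / 8 : ℝ≥0) * η 0
  batch : ∀ i, 1 ≤ i → i < I → (μ i : ℝ≥0∞) / (batchSize n i : ℝ≥0∞) ≤ (7 / 8 : ℝ≥0) * η i

section

variable {c : ℕ → ℕ} {I : ℕ} {μ : ℕ → ℕ} {η : ℕ → ℝ≥0}

theorem Thresholds.trialStart_pos (hT : Thresholds n c I μ η) {i : ℕ} (hi : 1 ≤ i) :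
    0 < trialStart c i := by
  obtain ⟨j, rfl⟩ := Nat.exists_eq_add_of_le' hi
  rw [trialStart_succ]
  have := hT.trials_pos j
  omega

theorem Thresholds.length_trials_pos (hT : Thresholds n c I μ η) : 0 < (trials n c).length := by
  rw [length_trials]
  exact hT.trialStart_pos (hT.one_le.trans hT.le_log)

variable {input : Fin n → List Op} {s : Config n} {q : Fin n}

theorem Thresholds.cost_lt (hT : Thresholds n c I μ η) (h : WellFormed input s)
    (hs : s ∈ balanced c input I μ) (hop : (input q)[s.pc q]? = some Op.get) :
    s.cost q (s.pc q) < trialStart c I := by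
  by_contra hlt
  have h1 : q ∈ pastSet input s (batchStart n I) (trialStart c I) := by
    rw [mem_pastSet, Past, h.held_eq_none hop]
    exact ⟨hop, not_lt.1 hlt⟩
  have h2 := hs I hT.one_le le_rfl
  have := Finset.card_pos.2 ⟨q, h1⟩
  rw [hT.last] at h2
  omega

theorem Thresholds.failProb_le (hT : Thresholds n c I μ η) (h : WellFormed input s)
    (hs : s ∈ balanced c input I μ) {i f : ℕ} (hi : i < I) (h1 : trialStart c i ≤ f)
    (h2 : f < trialStart c (i + 1)) : failProb c s f ≤ (7 / 8 : ℝ≥0) * η i := by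
  refine (h.failProb_le (hi.trans_le hT.le_log) h1 h2 (trialStart c i)).trans ?_
  -- Batch `0` needs no balance: at most `n` of its locations can be occupied.
  rcases Nat.eq_zero_or_pos i with rfl | hi0
  · refine le_trans ?_ hT.first_batch
    gcongr
    exact (Finset.card_le_univ _).trans (by simp)
  · refine le_trans ?_ (hT.batch i hi0 hi)
    gcongr
    exact hs i hi0 hi.le

theorem Thresholds.failProb_le' (hT : Thresholds n c I μ η) (h : WellFormed input s)
    (hs : s ∈ balanced c input I μ) (hop : (input q)[s.pc q]? = some Op.get) :
    failProb c s (s.cost q (s.pc q)) ≤ (7 / 8 : ℝ≥0) := by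
  obtain ⟨i, hi, h1, h2⟩ := exists_batch_of_lt (hT.cost_lt h hs hop)
  refine (hT.failProb_le h hs hi h1 h2).trans ?_
  exact mul_le_of_le_one_right' (by exact_mod_cast hT.η_le_one i)

/-! ### The number of participants that get to a batch -/

/-- The level that corresponds to batch `i + 1`. -/
noncomputable def batchLevel (n : ℕ) (c : ℕ → ℕ) (η : ℕ → ℝ≥0) (i : ℕ) : Level where
  θ := 7 / 8
  η := η i
  a := batchStart n (i + 1)
  b := trialStart c (i + 1)
  w := c i
  w_le := by rw [trialStart_succ]; omega

theorem Level.geom_le (P : Level) (hθ : P.θ = 7 / 8) (m : ℕ) : P.geom m ≤ 8 * P.η ^ P.w := by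
  -- The second term is the tail of the infinite series, since `1 / (1 - 7/8) = 8`.
  have h : P.geom m + 8 * P.η ^ P.w * P.θ ^ m = 8 * P.η ^ P.w := by
    induction m with
    | zero => simp [geom]
    | succ m ih =>
      rw [geom_succ, pow_succ, add_assoc]
      nth_rw 2 [← ih]
      congr 1
      have h8 : 8 * P.θ = 7 := by
        rw [hθ, mul_div_cancel₀]
        norm_num
      calc P.η ^ P.w * P.θ ^ m + 8 * P.η ^ P.w * (P.θ ^ m * P.θ)
          = P.η ^ P.w * P.θ ^ m * (1 + 8 * P.θ) := by ring
        _ = _ := by rw [h8]; ring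
  rw [← h]
  exact le_self_add

/-- The product of the potentials, as an exponential moment, at time `t` for the target time `T`. -/
noncomputable def Level.prodPot (P : Level) (e : Execution n) (r : ℝ≥0) (T t : ℕ)
    (s : Config n) : ℝ≥0∞ :=
  ∏ q, (1 + r * (P.pot (T + 1) e.input s q (e.localTime q T - e.localTime q t) : ℝ≥0∞))

theorem Thresholds.mean_step_pot (hT : Thresholds n c I μ η) (h : WellFormed input s)
    (hs : s ∈ balanced c input I μ) {i : ℕ} (hi : i < I) {τ r : ℕ} (hτ : r + 1 < τ) :
    mean (Config.step c input q s) (fun s' => (batchLevel n c η i).pot τ input s' q r) ≤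
      (batchLevel n c η i).pot τ input s q (r + 1) := by
  by_cases hop : (input q)[s.pc q]? = some Op.get
  · refine Level.mean_step_of_get h hop (hT.failProb_le' h hs hop) (fun h1 h2 => ?_) ?_
      (hT.η_le_one i) ?_
    · refine hT.failProb_le h hs hi ?_ h2
      change trialStart c (i + 1) ≤ _ + c i at h1
      rw [trialStart_succ] at h1
      omega
    · change (7 / 8 : ℝ≥0) ≤ 1
      rw [div_le_one (by norm_num)]
      norm_num
    · intro f hf x hx
      exact lt_batchStart_of_mem_support_probe (by have := hT.le_log; omega) hf hx
  · exact Level.mean_step_of_ne_get h hop hτ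

/-- Only the factor of the scheduled participant changes, so the others can be pulled out of the
mean. No independence is needed. -/
theorem Thresholds.mean_step_prodPot (hT : Thresholds n c I μ η) {e : Execution n} {t T : ℕ}
    (h : WellFormed e.input s) (hs : s ∈ balanced c e.input I μ) {i : ℕ} (hi : i < I)
    (r : ℝ≥0) (ht : t < T) :
    mean (Config.step c e.input (e.schedule t) s) ((batchLevel n c η i).prodPot e r T (t + 1)) ≤
      (batchLevel n c η i).prodPot e r T t s := by
  classical
  set q := e.schedule t with hq
  set P := batchLevel n c η i
  set R : ℝ≥0∞ := ∏ q' ∈ Finset.univ.erase q,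
    (1 + r * (P.pot (T + 1) e.input s q' (e.localTime q' T - e.localTime q' t) : ℝ≥0∞)) with hR
  have h1 : e.localTime q (t + 1) = e.localTime q t + 1 := e.localTime_succ_self t
  have h2 : e.localTime q (t + 1) ≤ e.localTime q T := e.localTime_mono q ht
  have h3 : e.localTime q T ≤ T := e.localTime_le q T
  have h4 : e.localTime q T - e.localTime q t = e.localTime q T - e.localTime q (t + 1) + 1 := by
    omega
  calc mean (Config.step c e.input q s) (P.prodPot e r T (t + 1))
      ≤ mean (Config.step c e.input q s) (fun s' => R * (1 +
          r * (P.pot (T + 1) e.input s' q (e.localTime q T - e.localTime q (t + 1)) : ℝ≥0∞))) := by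
        refine mean_mono_of_support fun s' hs' => le_of_eq ?_
        rw [Level.prodPot, ← Finset.mul_prod_erase _ _ (Finset.mem_univ q), mul_comm, hR]
        congr 1
        refine Finset.prod_congr rfl fun q' hq' => ?_
        have hne := Finset.ne_of_mem_erase hq'
        have hm := move_of_mem_support h ((PMF.mem_support_iff _ _).2 hs')
        obtain ⟨f1, f2, f3⟩ := hm.frame hne
        rw [e.localTime_succ_of_ne hne, Level.pot, Level.pot, f1, f2, f3]
    _ = R * (1 + r * mean (Config.step c e.input q s) (fun s' =>
          (P.pot (T + 1) e.input s' q (e.localTime q T - e.localTime q (t + 1)) : ℝ≥0∞))) := by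
        rw [mean_const_mul, mean_add, mean_const, mean_const_mul]
    _ ≤ R * (1 + r * (P.pot (T + 1) e.input s q
          (e.localTime q T - e.localTime q (t + 1) + 1) : ℝ≥0∞)) := by
        gcongr
        exact hT.mean_step_pot h hs hi (by omega)
    _ = P.prodPot e r T t s := by
        rw [Level.prodPot, ← Finset.mul_prod_erase _ _ (Finset.mem_univ q), mul_comm, ← h4]

variable {e : Execution n}

/-- The law of the execution that is stopped at the first configuration that is not balanced. -/
noncomputable def Execution.killedLaw (e : Execution n) (c : ℕ → ℕ) (I : ℕ) (μ : ℕ → ℕ) :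
    ℕ → Config n → ℝ≥0∞ :=
  killed (Config.init n) (fun t => Config.step c e.input (e.schedule t)) (balanced c e.input I μ)

theorem Thresholds.mean_prodPot_le (hT : Thresholds n c I μ η) {i : ℕ} (hi : i < I)
    (r : ℝ≥0) (T : ℕ) :
    mean (e.killedLaw c I μ T) ((batchLevel n c η i).prodPot e r T T) ≤
      (1 + r * (8 * η i ^ c i : ℝ≥0)) ^ n := by
  refine (mean_killed_le (I := Reachable e c) (reachable_init e c hT.length_trials_pos)
    (fun t s hs _ => hs.step) (f := (batchLevel n c η i).prodPot e r T)
    fun t ht s hI hs => hT.mean_step_prodPot hI.wellFormed hs hi r ht).trans ?_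
  rw [Level.prodPot]
  have hq : ∀ q ∈ Finset.univ, (1 + r * ((batchLevel n c η i).pot (T + 1) e.input (Config.init n) q
      (e.localTime q T - e.localTime q 0) : ℝ≥0∞)) ≤ 1 + r * (8 * η i ^ c i : ℝ≥0) := by
    intro q _
    gcongr
    exact (Level.pot_init_le _ _ _ _).trans (Level.geom_le _ rfl _)
  refine (Finset.prod_le_pow_card _ _ _ hq).trans_eq ?_
  rw [Finset.card_univ, Fintype.card_fin]

/-- Markov's inequality for an exponential moment: at the target time every participant past the
batch contributes a factor of at least `1 + r` to the product. -/
theorem Thresholds.mean_card_le (hT : Thresholds n c I μ η) {i : ℕ} (hi : i < I)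
    (r : ℝ≥0) (T m : ℕ) :
    (1 + r : ℝ≥0∞) ^ m * mean (e.killedLaw c I μ T)
      ({s | m ≤ (pastSet e.input s (batchStart n (i + 1)) (trialStart c (i + 1))).card}.indicator 1)
      ≤ (1 + r * (8 * η i ^ c i : ℝ≥0)) ^ n := by
  refine le_trans ?_ (hT.mean_prodPot_le (e := e) hi r T)
  rw [← mean_const_mul]
  refine mean_mono_of_support fun s hs => ?_
  have hI := killed_invariant (I := Reachable e c) (reachable_init e c hT.length_trials_pos)
    (fun t s hs _ => hs.step) T s hs
  by_cases hm : m ≤ (pastSet e.input s (batchStart n (i + 1)) (trialStart c (i + 1))).card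
  · rw [Set.indicator_of_mem (by exact hm), Pi.one_apply, mul_one, Level.prodPot]
    calc (1 + r : ℝ≥0∞) ^ m
        ≤ (1 + r : ℝ≥0∞) ^ (pastSet e.input s (batchStart n (i + 1)) (trialStart c (i + 1))).card :=
          pow_le_pow_right₀ le_self_add hm
      _ = ∏ q ∈ pastSet e.input s (batchStart n (i + 1)) (trialStart c (i + 1)),
          (1 + r : ℝ≥0∞) := by rw [Finset.prod_const]
      _ ≤ ∏ q ∈ pastSet e.input s (batchStart n (i + 1)) (trialStart c (i + 1)),
          (1 + r * ((batchLevel n c η i).pot (T + 1) e.input s q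
            (e.localTime q T - e.localTime q T) : ℝ≥0∞)) := by
          refine Finset.prod_le_prod' fun q hq => ?_
          gcongr
          refine le_mul_of_one_le_right' ?_
          rw [Nat.sub_self, ENNReal.one_le_coe_iff]
          exact Level.one_le_pot_zero hI.wellFormed (Nat.succ_pos T) (mem_pastSet.1 hq)
      _ ≤ _ := Finset.prod_le_prod_of_subset_of_one_le' (Finset.subset_univ _)
          fun q _ _ => le_self_add
  · rw [Set.indicator_of_notMem (by exact hm), mul_zero]
    exact zero_le

/-! ### The expected cost of a `Get` -/

/-- The expected final cost of operation `k` of `q`, a `Get` all of whose test-and-sets fail with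
probability at most `7 / 8`, is at most this number. -/
noncomputable def costPot (q : Fin n) (k : ℕ) (s : Config n) : ℝ≥0∞ :=
  s.cost q k + if s.pc q ≤ k then 8 else 0

/-- A test-and-set costs `1` and leaves an expected remainder of at most `8 * (7/8) = 7`, which
together make up the reserve `8`. -/
theorem mean_step_costPot {q' : Fin n} {k : ℕ} (hk : (input q')[k]? = some Op.get)
    (h : WellFormed input s)
    (hp : (input q)[s.pc q]? = some Op.get → failProb c s (s.cost q (s.pc q)) ≤ (7 / 8 : ℝ≥0)) :
    mean (Config.step c input q s) (costPot q' k) ≤ costPot q' k s := by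
  by_cases hqk : q' = q ∧ k = s.pc q
  · obtain ⟨rfl, rfl⟩ := hqk
    have hstep : Config.step c input q' s =
        (probe n c (s.cost q' (s.pc q'))).map fun x => s.testAndSet q' x := by
      simp only [Config.step, hk]
    rw [hstep, mean_map]
    set f := s.cost q' (s.pc q') with hf
    have h78 : (8 : ℝ≥0∞) * ((7 / 8 : ℝ≥0) : ℝ≥0∞) = 7 := by
      have : (8 : ℝ≥0) * (7 / 8) = 7 := by rw [mul_div_cancel₀]; norm_num
      exact_mod_cast congrArg ((↑) : ℝ≥0 → ℝ≥0∞) this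
    calc mean (probe n c f) (fun x => costPot q' (s.pc q') (s.testAndSet q' x))
        ≤ mean (probe n c f) (fun x => ((f : ℝ≥0∞) + 1) + 8 * (if s.mem x then 1 else 0)) := by
          refine mean_mono_of_support fun x hx => ?_
          rw [costPot, Config.testAndSet]
          split_ifs <;> simp_all [Config.tick, Config.next]
      _ = (f + 1) + 8 * failProb c s f := by rw [mean_add, mean_const, mean_const_mul, failProb]
      _ ≤ (f + 1) + 8 * (7 / 8 : ℝ≥0) := by gcongr; exact hp hk
      _ = f + 8 := by rw [h78, add_assoc]; norm_num
      _ = costPot q' (s.pc q') s := by rw [costPot, if_pos le_rfl]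
  · refine mean_le_of_support fun s' hs' => ?_
    have hm := move_of_mem_support h hs'
    have h1 : s'.cost q' k = s.cost q' k := by
      rcases hm.get_cost hk with h1 | ⟨h1, h2, -⟩
      · exact h1
      · exact absurd ⟨h1, h2⟩ hqk
    have h2 : s.pc q' ≤ s'.pc q' := by
      by_cases hq : q' = q
      · subst hq
        rcases hm.pc with ⟨-, rfl⟩ | ⟨_, -, -, h2⟩ | ⟨_, -, -, h2, -⟩ <;> omega
      · rw [(hm.frame hq).1]
    rw [costPot, costPot, h1]
    gcongr
    split_ifs <;> first | omega | simp

end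

/-! ### Leaving the balanced set, and its effect on cost and probability. -/

section

variable {c : ℕ → ℕ} {I : ℕ} {μ : ℕ → ℕ} {η : ℕ → ℝ≥0} {e : Execution n}

theorem Thresholds.reachable_of_killedLaw (hT : Thresholds n c I μ η) {t : ℕ} {s : Config n}
    (hs : e.killedLaw c I μ t s ≠ 0) : Reachable e c t s :=
  killed_invariant (I := Reachable e c) (reachable_init e c hT.length_trials_pos)
    (fun _ _ hs _ => hs.step) t s hs

/-- As long as the configuration is balanced, no `Get` gets beyond batch `I`. -/
theorem Thresholds.cost_le_of_killedLaw (hT : Thresholds n c I μ η) {t : ℕ} {s : Config n}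
    (hs : e.killedLaw c I μ t s ≠ 0) {q : Fin n} {k : ℕ} (hk : e.IsGet q k) :
    s.cost q k ≤ trialStart c I := by
  refine (killed_invariant (I := fun t s => Reachable e c t s ∧
    ∀ q k, e.IsGet q k → s.cost q k ≤ trialStart c I)
    ⟨reachable_init e c hT.length_trials_pos, fun _ _ _ => Nat.zero_le _⟩ ?_ t s hs).2 q k hk
  rintro t s ⟨hr, hc⟩ hb s' hs'
  refine ⟨hr.step s' hs', fun q k hk => ?_⟩
  rcases (move_of_mem_support hr.wellFormed hs').get_cost hk with h1 | ⟨rfl, rfl, h1⟩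
  · rw [h1]
    exact hc q k hk
  · rw [h1]
    exact hT.cost_lt hr.wellFormed hb hk

theorem Thresholds.balanced_init (hT : Thresholds n c I μ η) :
    Config.init n ∈ balanced c e.input I μ := by
  intro i hi _
  have h : pastSet e.input (Config.init n) (batchStart n i) (trialStart c i) = ∅ := by
    ext q
    have := hT.trialStart_pos hi
    simp only [mem_pastSet, Past, Config.init, Finset.notMem_empty, iff_false, not_and, not_le]
    exact fun _ => this
  simp [h]

/-- The probability that the execution is stopped now is `0` unless a `Get` can have taken the last
step. -/
theorem Thresholds.mean_killedLaw_eq_zero (hT : Thresholds n c I μ η) {t : ℕ}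
    (ht : ¬ e.GetTime c t) :
    mean (e.killedLaw c I μ (t + 1)) ((balanced c e.input I μ)ᶜ.indicator 1) = 0 := by
  classical
  rw [Execution.killedLaw, mean_killed_succ, mean, ENNReal.tsum_eq_zero]
  intro s
  rw [mul_eq_zero, or_iff_not_imp_left]
  intro hs
  have hr := hT.reachable_of_killedLaw hs
  split_ifs with hb
  · refine le_antisymm (mean_le_of_support fun s' hs' => ?_) zero_le
    have hm := move_of_mem_support hr.wellFormed hs'
    rw [Set.indicator_of_notMem]
    rw [Set.notMem_compl_iff]
    intro i hi1 hi2
    refine (Finset.card_le_card fun q' hq' => ?_).trans (hb i hi1 hi2)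
    rw [mem_pastSet] at hq' ⊢
    refine (hm.past hr.wellFormed (hT.trialStart_pos hi1) (fun f hf x hx =>
      lt_batchStart_of_mem_support_probe (hi2.trans hT.le_log) hf hx) hq').resolve_right ?_
    rintro ⟨-, hop, -⟩
    exact ht ⟨s, hr, hop⟩
  · rfl

/-- The probability that the configuration is ever unbalanced, if it is at most `ε` at any given
time. -/
theorem Thresholds.sum_killedLaw_le (hT : Thresholds n c I μ η) (T : ℕ) {ε : ℝ≥0∞}
    (hε : ∀ t, mean (e.killedLaw c I μ t) ((balanced c e.input I μ)ᶜ.indicator 1) ≤ ε) :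
    ∑ t ∈ Finset.range T, mean (e.killedLaw c I μ t) ((balanced c e.input I μ)ᶜ.indicator 1) ≤
      (e.numGetFree * (e.numGetFree * ((trials n c).length + n) + 1) : ℕ) * ε := by
  classical
  cases T with
  | zero => simp
  | succ T =>
    -- Splitting off time `0`, which is balanced, matches the mass killed at time `t + 1` with the
    -- step taken at time `t`.
    rw [Finset.sum_range_succ']
    have h0 : mean (e.killedLaw c I μ 0) ((balanced c e.input I μ)ᶜ.indicator 1) = 0 := by
      refine (mean_pure (Config.init n) _).trans ?_
      rw [Set.indicator_of_notMem]
      rw [Set.notMem_compl_iff]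
      exact hT.balanced_init
    rw [h0, add_zero]
    calc ∑ t ∈ Finset.range T,
          mean (e.killedLaw c I μ (t + 1)) ((balanced c e.input I μ)ᶜ.indicator 1)
        = ∑ t ∈ (Finset.range T).filter (e.GetTime c),
          mean (e.killedLaw c I μ (t + 1)) ((balanced c e.input I μ)ᶜ.indicator 1) := by
          rw [Finset.sum_filter]
          refine Finset.sum_congr rfl fun t _ => ?_
          split_ifs with h
          · rfl
          · exact hT.mean_killedLaw_eq_zero h
      _ ≤ ((Finset.range T).filter (e.GetTime c)).card * ε := by
          rw [← nsmul_eq_mul]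
          exact Finset.sum_le_card_nsmul _ _ _ fun t _ => hε _
      _ ≤ _ := by
          gcongr
          exact e.card_getTime_le c T

theorem Thresholds.mean_law_le (hT : Thresholds n c I μ η) (T : ℕ) {δ B : ℝ≥0∞}
    (hδ : ∑ t ∈ Finset.range T,
      mean (e.killedLaw c I μ t) ((balanced c e.input I μ)ᶜ.indicator 1) ≤ δ)
    (f : Config n → ℝ≥0∞) (hf : ∀ s, Reachable e c T s → f s ≤ B) :
    mean (e.law c T) f ≤ mean (e.killedLaw c I μ T) f + B * δ := by
  rw [e.law_eq_chain]
  refine (mean_chain_le (G := balanced c e.input I μ) (I := Reachable e c)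
    (reachable_init e c hT.length_trials_pos) (fun t s hs => hs.step) B T f hf).trans ?_
  exact add_le_add le_rfl (mul_le_mul_right hδ _)

/-- The killed chain contributes at most `8` by the supermartingale `costPot`. The rest has mass at
most `δ`, and there the worst case is all trials plus the whole backup array. -/
theorem Thresholds.expectedCost_le (hT : Thresholds n c I μ η) (T : ℕ) {δ : ℝ≥0∞}
    (hδ : ∑ t ∈ Finset.range T,
      mean (e.killedLaw c I μ t) ((balanced c e.input I μ)ᶜ.indicator 1) ≤ δ)
    {q : Fin n} {k : ℕ} (hk : e.IsGet q k) :
    e.expectedCost c T q k ≤ 8 + ((trials n c).length + n : ℕ) * δ := by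
  refine (hT.mean_law_le T hδ (B := ((trials n c).length + n : ℕ))
    (fun s => (s.cost q k : ℝ≥0∞)) (fun s hs => ?_)).trans ?_
  · exact Nat.cast_le.2 (hs.get_cost q k hk)
  gcongr
  calc mean (e.killedLaw c I μ T) (fun s => (s.cost q k : ℝ≥0∞))
      ≤ mean (e.killedLaw c I μ T) (costPot q k) :=
        mean_mono_of_support fun s _ => le_self_add
    _ ≤ costPot q k (Config.init n) := by
        refine mean_killed_le (I := Reachable e c) (reachable_init e c hT.length_trials_pos)
          (fun t s hs _ => hs.step) (f := fun _ => costPot q k) fun t _ s hr hb => ?_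
        exact mean_step_costPot hk hr.wellFormed fun hop => hT.failProb_le' hr.wellFormed hb hop
    _ = 8 := by simp [costPot, Config.init]

theorem Thresholds.le_probAllGetsWithin (hT : Thresholds n c I μ η) (T : ℕ) {δ : ℝ≥0∞}
    (hδ : ∑ t ∈ Finset.range T,
      mean (e.killedLaw c I μ t) ((balanced c e.input I μ)ᶜ.indicator 1) ≤ δ)
    {b : ℝ} (hb : (trialStart c I : ℝ) ≤ b) :
    1 - δ ≤ e.probAllGetsWithin c T b := by
  classical
  set A : Set (Config n) := {s | ∀ q k, e.IsGet q k → (s.cost q k : ℝ) ≤ b} with hA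
  have h1 : e.probAllGetsWithin c T b = mean (e.law c T) (A.indicator 1) := by
    rw [Execution.probAllGetsWithin, PMF.toOuterMeasure_apply]
    refine tsum_congr fun s => ?_
    by_cases hs : s ∈ A
    · simp [hs, ← hA]
    · simp [hs, ← hA]
  have h2 : mean (e.law c T) (Aᶜ.indicator 1) ≤ δ := by
    refine (hT.mean_law_le T hδ (B := 1) (Aᶜ.indicator 1) (fun s _ => ?_)).trans ?_
    · exact Set.indicator_le_self' (fun _ _ => zero_le) s
    · rw [one_mul]
      refine (add_le_add_left (le_of_eq ?_) δ).trans (zero_add δ).le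
      rw [mean, ENNReal.tsum_eq_zero]
      intro s
      rw [mul_eq_zero, or_iff_not_imp_left]
      intro hs
      rw [Set.indicator_of_notMem]
      rw [Set.notMem_compl_iff]
      exact fun q k hk => le_trans (by exact_mod_cast hT.cost_le_of_killedLaw hs hk) hb
  have h3 : mean (e.law c T) (A.indicator 1) + mean (e.law c T) (Aᶜ.indicator 1) = 1 := by
    rw [← mean_add, ← mean_const (e.law c T) 1]
    congr 1
    funext s
    by_cases hs : s ∈ A <;> simp [hs]
  rw [h1, tsub_le_iff_right, ← h3]
  gcongr

/-- The probability that the configuration is unbalanced at a given time. -/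
theorem mean_unbalanced_le (t : ℕ) {ε : ℝ≥0∞}
    (hε : ∀ i < I, mean (e.killedLaw c I μ t)
      ({s | μ (i + 1) + 1 ≤ (pastSet e.input s (batchStart n (i + 1))
        (trialStart c (i + 1))).card}.indicator 1) ≤ ε) :
    mean (e.killedLaw c I μ t) ((balanced c e.input I μ)ᶜ.indicator 1) ≤ I * ε := by
  classical
  calc mean (e.killedLaw c I μ t) ((balanced c e.input I μ)ᶜ.indicator 1)
      ≤ mean (e.killedLaw c I μ t) (fun s => ∑ i ∈ Finset.range I,
        {s | μ (i + 1) + 1 ≤ (pastSet e.input s (batchStart n (i + 1))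
          (trialStart c (i + 1))).card}.indicator 1 s) := by
        refine mean_mono_of_support fun s _ => ?_
        by_cases hs : s ∈ balanced c e.input I μ
        · rw [Set.indicator_of_notMem (by simpa using hs)]
          exact zero_le
        · rw [Set.indicator_of_mem (by simpa using hs)]
          simp only [balanced, Set.mem_ofPred_eq, not_forall, not_le] at hs
          obtain ⟨i, hi1, hi2, hi3⟩ := hs
          obtain ⟨j, rfl⟩ := Nat.exists_eq_add_of_le' hi1
          refine le_trans (le_of_eq ?_) (Finset.single_le_sum (fun _ _ => zero_le)
            (Finset.mem_range.2 (show j < I by omega)))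
          rw [Set.indicator_of_mem (by exact hi3)]
    _ = ∑ i ∈ Finset.range I, mean (e.killedLaw c I μ t)
        ({s | μ (i + 1) + 1 ≤ (pastSet e.input s (batchStart n (i + 1))
          (trialStart c (i + 1))).card}.indicator 1) := by
        simp only [mean, Finset.mul_sum]
        exact Summable.tsum_finsetSum fun _ _ => ENNReal.summable
    _ ≤ I * ε := by
        refine (Finset.sum_le_card_nsmul _ _ ε fun i hi => hε i (Finset.mem_range.1 hi)).trans_eq ?_
        rw [Finset.card_range, nsmul_eq_mul]

end

/-! ### The thresholds -/

/-- Up to a factor `7 / 8`, the probability that a trial in batch `i` fails. -/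
noncomputable def failBound (i : ℕ) : ℝ≥0 := if i = 0 then 6 / 7 else (1 / 2) ^ 2 ^ i

/-- The number of participants that may get to batch `i`. -/
def threshold (n i : ℕ) : ℕ :=
  if i < Nat.log 2 (Nat.log 2 n) then batchSize n i / 2 ^ (2 ^ i + 1) else 0

theorem failBound_le_one (i : ℕ) : failBound i ≤ 1 := by
  unfold failBound
  split_ifs
  · rw [div_le_one (by norm_num)]
    norm_num
  · exact pow_le_one₀ zero_le (by rw [div_le_one (by norm_num)]; norm_num)

/-- In batch `i ≥ 1` the threshold is at most half of `failBound i` times the batch size. In batch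
`0` the ratio is about `2/3`; the bound `3/4 = 7/8 * 6/7` leaves room for the rounding of `3n/2`. -/
theorem thresholds (hn : 16 ≤ n) {c : ℕ → ℕ} (hc : ∀ i, 0 < c i) :
    Thresholds n c (Nat.log 2 (Nat.log 2 n)) (threshold n) failBound where
  one_le := by
    have h4 : 4 ≤ Nat.log 2 n := Nat.le_log_of_pow_le (by norm_num) (by simpa using hn)
    exact Nat.le_log_of_pow_le (by norm_num) (by omega)
  le_log := Nat.log_le_self _ _
  last := by simp [threshold]
  trials_pos := hc
  η_le_one := failBound_le_one
  first_batch := by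
    have h2 : batchSize n 0 = 3 * n / 2 := rfl
    have h3 : 0 < batchSize n 0 := by omega
    refine ENNReal.div_le_of_le_mul ?_
    have h1 : (7 / 8 : ℝ≥0) * failBound 0 = 3 / 4 := by
      rw [failBound, if_pos rfl]
      ext
      push_cast
      norm_num
    rw [← ENNReal.coe_mul, h1]
    have h4 : 4 * n ≤ 3 * batchSize n 0 := by omega
    have h5 : (n : ℝ≥0) ≤ 3 / 4 * (batchSize n 0 : ℝ≥0) := by
      have h6 : (4 : ℝ) * n ≤ 3 * batchSize n 0 := by exact_mod_cast h4
      rw [← NNReal.coe_le_coe]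
      push_cast
      linarith
    exact_mod_cast ENNReal.coe_le_coe.2 h5
  batch i hi hiI := by
    refine ENNReal.div_le_of_le_mul ?_
    have h1 : threshold n i * 2 ^ (2 ^ i + 1) ≤ batchSize n i := by
      rw [threshold, if_pos hiI]
      exact Nat.div_mul_le_self _ _
    have h5 : (threshold n i : ℝ≥0) ≤ 7 / 8 * failBound i * (batchSize n i : ℝ≥0) := by
      have h6 : (threshold n i : ℝ) * 2 ^ (2 ^ i + 1) ≤ batchSize n i := by exact_mod_cast h1
      rw [← NNReal.coe_le_coe, failBound, if_neg (by omega)]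
      push_cast
      have h7 : (0 : ℝ) < 2 ^ 2 ^ i := by positivity
      rw [div_pow, one_pow, mul_one_div, div_mul_eq_mul_div, le_div_iff₀ h7]
      rw [pow_succ] at h6
      have h8 : (0 : ℝ) ≤ threshold n i * 2 ^ 2 ^ i := by positivity
      linarith
    exact_mod_cast ENNReal.coe_le_coe.2 h5

/-! ### Chernoff bounds for the thresholds. -/

theorem Thresholds.mean_card_le_exp {c : ℕ → ℕ} {I : ℕ} {μ : ℕ → ℕ} {η : ℕ → ℝ≥0}
    {e : Execution n} (hT : Thresholds n c I μ η) {i : ℕ} (hi : i < I) (r : ℝ≥0) (t m : ℕ) :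
    mean (e.killedLaw c I μ t)
      ({s | m ≤ (pastSet e.input s (batchStart n (i + 1)) (trialStart c (i + 1))).card}.indicator 1)
      ≤ ENNReal.ofReal (Real.exp (n * (r * (8 * (η i : ℝ) ^ c i))) / (1 + r) ^ m) := by
  have h := hT.mean_card_le (e := e) hi r t m
  rw [ENNReal.ofReal_div_of_pos (by positivity), ENNReal.le_div_iff_mul_le]
  rotate_left
  · left
    rw [ne_eq, ENNReal.ofReal_eq_zero, not_le]
    positivity
  · exact Or.inl ENNReal.ofReal_ne_top
  have h1 : ENNReal.ofReal ((1 + r : ℝ) ^ m) = (1 + r : ℝ≥0∞) ^ m := by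
    rw [ENNReal.ofReal_pow (by positivity), ENNReal.ofReal_add zero_le_one r.coe_nonneg]
    simp
  rw [h1, mul_comm]
  refine h.trans ?_
  set y : ℝ≥0 := r * (8 * η i ^ c i) with hy
  have h2 : (1 + (r : ℝ≥0∞) * ((8 * η i ^ c i : ℝ≥0) : ℝ≥0∞)) = ENNReal.ofReal (1 + y) := by
    rw [ENNReal.ofReal_add zero_le_one y.coe_nonneg, ENNReal.ofReal_coe_nnreal, hy, ENNReal.coe_mul r]
    simp
  rw [h2, ← ENNReal.ofReal_pow (by positivity)]
  refine ENNReal.ofReal_le_ofReal ?_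
  have h3 : (r * (8 * (η i : ℝ) ^ c i)) = y := by
    rw [hy]
    push_cast
    rfl
  rw [h3, Real.exp_nat_mul]
  have := Real.add_one_le_exp (y : ℝ)
  exact pow_le_pow_left₀ (by positivity) (by linarith) _

/-- A constant number of trials in batch `i` squares the failure rate and more, which makes up for
the doubly exponential decrease of the thresholds. The `8` in the exponent covers the constants of
the Chernoff bound. -/
theorem failBound_pow_le {κ i : ℕ} (hκ : 64 ≤ κ) :
    (failBound i : ℝ) ^ κ * 2 ^ (2 ^ (i + 1) + i + 8) ≤ 1 := by
  unfold failBound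
  split_ifs with h
  · subst h
    push_cast
    have h1 : (6 / 7 : ℝ) ^ κ ≤ (6 / 7) ^ 64 :=
      pow_le_pow_of_le_one (by norm_num) (by norm_num) hκ
    calc (6 / 7 : ℝ) ^ κ * 2 ^ (2 ^ (0 + 1) + 0 + 8)
        ≤ (6 / 7) ^ 64 * 2 ^ (2 ^ (0 + 1) + 0 + 8) := by gcongr
      _ ≤ 1 := by norm_num
  · push_cast
    rw [div_pow, one_pow, div_pow, one_pow, ← pow_mul, one_div, inv_mul_le_iff₀ (by positivity),
      mul_one]
    refine pow_le_pow_right₀ (by norm_num) ?_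
    have h1 : i < 2 ^ i := Nat.lt_two_pow_self
    rw [pow_succ]
    nlinarith

theorem lt_threshold_mul {j : ℕ} (hj : 1 ≤ j) (hjI : j < Nat.log 2 (Nat.log 2 n)) :
    n < (threshold n j + 1) * 2 ^ (2 ^ j + j + 2) := by
  rw [threshold, if_pos hjI, batchSize, if_neg (by omega), Nat.div_div_eq_div_mul, ← pow_add,
    show j + 1 + (2 ^ j + 1) = 2 ^ j + j + 2 by ring, mul_comm]
  exact Nat.lt_mul_div_succ _ (by positivity)

theorem two_pow_two_pow_le (hn : 16 ≤ n) {j : ℕ} (hjI : j < Nat.log 2 (Nat.log 2 n)) :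
    2 * 2 ^ j ≤ Nat.log 2 n ∧ (2 ^ 2 ^ j) ^ 2 ≤ n := by
  have h4 : 4 ≤ Nat.log 2 n := Nat.le_log_of_pow_le (by norm_num) (by simpa using hn)
  have h1 : 2 ^ (j + 1) ≤ Nat.log 2 n := Nat.pow_le_of_le_log (by omega) hjI
  rw [pow_succ, mul_comm] at h1
  refine ⟨h1, ?_⟩
  rw [← pow_mul, mul_comm]
  exact Nat.pow_le_of_le_log (by omega) h1

/-- Before the last level `2^(2^j) ≤ √n`, so the thresholds are of order at least `√n / log n`,
large enough for concentration. -/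
theorem le_threshold (hn : 16 ≤ n) {j : ℕ} (hj : 1 ≤ j) (hjI : j < Nat.log 2 (Nat.log 2 n)) :
    √(n : ℝ) ≤ (threshold n j + 1 : ℕ) * (2 * Nat.log 2 n : ℝ) := by
  obtain ⟨h1, h2⟩ := two_pow_two_pow_le hn hjI
  have h3 := lt_threshold_mul hj hjI
  have hs : (0 : ℝ) < √n := Real.sqrt_pos.2 (by exact_mod_cast (by omega : 0 < n))
  have h4 : (2 : ℝ) ^ 2 ^ j ≤ √n := Real.le_sqrt_of_sq_le (by exact_mod_cast h2)
  have h5 : (2 : ℝ) * 2 ^ j ≤ Nat.log 2 n := by exact_mod_cast h1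
  have h6 : (n : ℝ) ≤ (threshold n j + 1 : ℕ) * 2 ^ (2 ^ j + j + 2) := by exact_mod_cast h3.le
  have h7 : √(n : ℝ) * √n = n := Real.mul_self_sqrt (by positivity)
  refine le_of_mul_le_mul_right ?_ hs
  calc √(n : ℝ) * √n = n := h7
    _ ≤ (threshold n j + 1 : ℕ) * 2 ^ (2 ^ j + j + 2) := h6
    _ = (threshold n j + 1 : ℕ) * (2 * (2 * 2 ^ j)) * 2 ^ 2 ^ j := by ring
    _ ≤ (threshold n j + 1 : ℕ) * (2 * Nat.log 2 n) * √n := by gcongr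

theorem natLog_le_two_mul_log : (Nat.log 2 n : ℝ) ≤ 2 * Real.log n := by
  rcases Nat.eq_zero_or_pos n with rfl | hn
  · simp
  refine (Real.natLog_le_logb n 2).trans ?_
  have h0 : 0 ≤ Real.log n := Real.log_natCast_nonneg n
  have h2 := Real.log_two_gt_d9
  rw [Real.logb, Nat.cast_ofNat, div_le_iff₀ (by linarith)]
  nlinarith

/-- The probability that too many participants get to a batch, at a given time. -/
theorem mean_past_le (hn : 16 ≤ n) {κ : ℕ} (hκ : 16 ≤ κ)
    (hlarge : 16 * κ * Real.log n ^ 2 ≤ √n) {c : ℕ → ℕ} (hc : ∀ i, 4 * κ ≤ c i)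
    (e : Execution n) (t i : ℕ) (hi : i < Nat.log 2 (Nat.log 2 n)) :
    mean (e.killedLaw c (Nat.log 2 (Nat.log 2 n)) (threshold n) t)
      ({s | threshold n (i + 1) + 1 ≤ (pastSet e.input s (batchStart n (i + 1))
        (trialStart c (i + 1))).card}.indicator 1) ≤
      ENNReal.ofReal (24 * n * ((n : ℝ) ^ κ)⁻¹) := by
  have hT := thresholds hn (c := c) (fun i => lt_of_lt_of_le (by omega) (hc i))
  have hn0 : (0 : ℝ) < n := by exact_mod_cast (by omega : 0 < n)
  have hn1 : (1 : ℝ) ≤ n := by exact_mod_cast (by omega : 1 ≤ n)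
  have hηc : (failBound i : ℝ) ^ c i ≤ (failBound i : ℝ) ^ (4 * κ) :=
    pow_le_pow_of_le_one (failBound i).2 (by exact_mod_cast failBound_le_one i) (hc i)
  rcases Nat.lt_or_ge (i + 1) (Nat.log 2 (Nat.log 2 n)) with hi1 | hi1
  -- With `r = 1` the expected number past the batch is far below the threshold: the numerator is at
  -- most `exp (m/4)` and the denominator at least `exp (m/2)`.
  · refine (hT.mean_card_le_exp hi 1 t _).trans (ENNReal.ofReal_le_ofReal ?_)
    set m := threshold n (i + 1) + 1 with hm
    have h1 : (n : ℝ) ≤ m * 2 ^ (2 ^ (i + 1) + (i + 1) + 2) := by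
      exact_mod_cast (lt_threshold_mul (by omega) hi1).le
    have h2 := failBound_pow_le (κ := 4 * κ) (i := i) (by omega)
    have h3 : n * (((1 : ℝ≥0) : ℝ) * (8 * (failBound i : ℝ) ^ c i)) ≤ m / 4 := by
      calc n * (((1 : ℝ≥0) : ℝ) * (8 * (failBound i : ℝ) ^ c i))
          ≤ (m * 2 ^ (2 ^ (i + 1) + (i + 1) + 2)) * (8 * (failBound i : ℝ) ^ (4 * κ)) := by
            rw [NNReal.coe_one, one_mul]
            gcongr
        _ = m / 4 * ((failBound i : ℝ) ^ (4 * κ) * 2 ^ (2 ^ (i + 1) + i + 8)) := by ring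
        _ ≤ m / 4 * 1 := by gcongr
        _ = m / 4 := mul_one _
    have h4 : Real.exp (m / 2) ≤ (1 + ((1 : ℝ≥0) : ℝ)) ^ m := by
      have h5 : Real.exp (1 / 2) ≤ 2 := by
        have h6 : Real.exp (1 / 2) ^ 2 = Real.exp 1 := by
          rw [← Real.exp_nat_mul]
          norm_num
        have := Real.exp_one_lt_d9
        have := Real.exp_pos (1 / 2)
        nlinarith
      calc Real.exp (m / 2) = Real.exp (1 / 2) ^ m := by
            rw [← Real.exp_nat_mul]
            congr 1
            ring
        _ ≤ (1 + ((1 : ℝ≥0) : ℝ)) ^ m := by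
            refine pow_le_pow_left₀ (Real.exp_pos _).le (h5.trans ?_) _
            push_cast
            norm_num
    have h7 : κ * Real.log n ≤ m / 4 := by
      have h8 := le_threshold hn (by omega) hi1
      rw [← hm] at h8
      have h9 := natLog_le_two_mul_log (n := n)
      have hlog : 0 < Real.log n := Real.log_pos (by exact_mod_cast (by omega : 1 < n))
      have h10 : 16 * κ * Real.log n ^ 2 ≤ m * (4 * Real.log n) := by
        refine hlarge.trans (h8.trans (mul_le_mul_of_nonneg_left ?_ (Nat.cast_nonneg m)))
        linarith
      have h11 : (4 * κ * Real.log n) * (4 * Real.log n) ≤ m * (4 * Real.log n) := by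
        linarith
      have := le_of_mul_le_mul_right h11 (by positivity)
      linarith
    calc Real.exp (n * (((1 : ℝ≥0) : ℝ) * (8 * (failBound i : ℝ) ^ c i))) /
          (1 + ((1 : ℝ≥0) : ℝ)) ^ m
        ≤ Real.exp (m / 4) / Real.exp (m / 2) := by gcongr
      _ = Real.exp (-(m / 4)) := by
          rw [← Real.exp_sub]
          congr 1
          ring
      _ ≤ Real.exp (-(κ * Real.log n)) := by gcongr
      _ = ((n : ℝ) ^ κ)⁻¹ := by rw [Real.exp_neg, Real.exp_nat_mul, Real.exp_log hn0]
      _ ≤ 24 * n * ((n : ℝ) ^ κ)⁻¹ := le_mul_of_one_le_left (by positivity) (by linarith)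
  · have hiI : i + 1 = Nat.log 2 (Nat.log 2 n) := by omega
    have h4 : 4 ≤ Nat.log 2 n := Nat.le_log_of_pow_le (by norm_num) (by simpa using hn)
    have hI2 : 2 ≤ Nat.log 2 (Nat.log 2 n) := Nat.le_log_of_pow_le (by norm_num) (by omega)
    -- At the last level `4 * 2^i = 2^(I+1)` exceeds the rounded-down `log₂ n`. Each block of four
    -- trials thus gains a factor `1/n`, which is why `4 * κ` trials are required.
    have hη : (failBound i : ℝ) ^ 4 ≤ (n : ℝ)⁻¹ := by
      rw [failBound, if_neg (by omega)]
      push_cast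
      rw [div_pow, one_pow, div_pow, one_pow, one_div]
      refine inv_anti₀ hn0 ?_
      have h5 : Nat.log 2 n < 2 ^ (i + 1 + 1) := by
        rw [hiI]
        exact Nat.lt_pow_succ_log_self (by norm_num) _
      have h6 : n ≤ 2 ^ (2 ^ i * 4) := by
        refine (Nat.lt_pow_succ_log_self (b := 2) (by norm_num) n).le.trans ?_
        refine Nat.pow_le_pow_right (by norm_num) ?_
        rw [pow_succ, pow_succ] at h5
        omega
      rw [← pow_mul]
      exact_mod_cast h6
    have hη' : (failBound i : ℝ) ^ c i ≤ ((n : ℝ) ^ κ)⁻¹ := by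
      refine hηc.trans ?_
      rw [pow_mul, ← inv_pow]
      exact pow_le_pow_left₀ (by positivity) hη κ
    have hm : threshold n (i + 1) + 1 = 1 := by
      rw [threshold, if_neg (by omega)]
    rw [hm]
    -- The threshold is `0`, so a single participant must be excluded. This is the largest `r` for
    -- which the exponent is still bounded by `1`.
    set r : ℝ≥0 := (n : ℝ≥0) ^ κ / (8 * n) with hr
    have hrr : (r : ℝ) = (n : ℝ) ^ κ / (8 * n) := by
      rw [hr]
      push_cast
      rfl
    refine (hT.mean_card_le_exp hi r t 1).trans (ENNReal.ofReal_le_ofReal ?_)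
    rw [pow_one]
    have h5 : n * ((r : ℝ) * (8 * (failBound i : ℝ) ^ c i)) ≤ 1 := by
      calc n * ((r : ℝ) * (8 * (failBound i : ℝ) ^ c i))
          ≤ n * ((r : ℝ) * (8 * ((n : ℝ) ^ κ)⁻¹)) := by gcongr
        _ = 1 := by
          rw [hrr]
          field_simp
    have h6 : Real.exp (n * ((r : ℝ) * (8 * (failBound i : ℝ) ^ c i))) ≤ 3 := by
      refine (Real.exp_le_exp.2 h5).trans ?_
      have := Real.exp_one_lt_d9
      linarith
    have hrpos : 0 < (r : ℝ) := by
      rw [hrr]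
      positivity
    calc Real.exp (n * ((r : ℝ) * (8 * (failBound i : ℝ) ^ c i))) / (1 + r) ≤ 3 / r := by
          gcongr
          linarith
      _ = 24 * n * ((n : ℝ) ^ κ)⁻¹ := by
          rw [hrr]
          field_simp
          norm_num

/-! ### The union bound and the choice of constants. -/

theorem trialStart_le {c : ℕ → ℕ} {b : ℕ} (hc : ∀ i, c i ≤ b) (i : ℕ) :
    trialStart c i ≤ i * b := by
  refine (Finset.sum_le_card_nsmul _ _ b fun k _ => hc k).trans_eq ?_
  rw [Finset.card_range, smul_eq_mul]

theorem eventually_log_sq_le (κ : ℕ) :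
    ∀ᶠ n : ℕ in Filter.atTop, 16 * κ * Real.log n ^ 2 ≤ √(n : ℝ) := by
  have h := (isLittleO_log_rpow_rpow_atTop 2 (by norm_num : (0 : ℝ) < 1 / 2)).bound
    (c := 1 / (16 * κ + 1)) (by positivity)
  filter_upwards [tendsto_natCast_atTop_atTop.eventually h] with n hn
  have hlog : 0 ≤ Real.log n := Real.log_natCast_nonneg n
  rw [Real.rpow_two, ← Real.sqrt_eq_rpow, Real.norm_of_nonneg (by positivity),
    Real.norm_of_nonneg (Real.sqrt_nonneg _), one_div_mul_eq_div, le_div_iff₀ (by positivity)] at hn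
  nlinarith [sq_nonneg (Real.log n)]

/-- The probability that the execution is ever unbalanced. -/
theorem unbalanced_le {α γ A : ℝ} (hα : 1 < α) {κ cmax : ℕ} (hκ : 2 * α + γ + 6 ≤ κ)
    (hκ' : 16 ≤ κ) (hA : 1 ≤ A) (hn : 16 ≤ n) (hlarge : 16 * κ * Real.log n ^ 2 ≤ √n)
    (hnA : 24 * A ^ 2 * (cmax + 2) ≤ n) {c : ℕ → ℕ} (hc : ∀ i, 4 * κ ≤ c i ∧ c i ≤ cmax)
    (e : Execution n) (he : (e.numGetFree : ℝ) ≤ A * (n : ℝ) ^ α) (T : ℕ) :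
    ∑ t ∈ Finset.range T, mean (e.killedLaw c (Nat.log 2 (Nat.log 2 n)) (threshold n) t)
      ((balanced c e.input (Nat.log 2 (Nat.log 2 n)) (threshold n))ᶜ.indicator 1) ≤
      ENNReal.ofReal ((n : ℝ) ^ (-(γ + 2))) := by
  have hT := thresholds hn (c := c) (fun i => lt_of_lt_of_le (by omega) (hc i).1)
  have hn0 : (0 : ℝ) < n := by exact_mod_cast (by omega : 0 < n)
  have hn1 : (1 : ℝ) ≤ n := by exact_mod_cast (by omega : 1 ≤ n)
  refine (hT.sum_killedLaw_le (e := e) T fun t => mean_unbalanced_le t fun i hi =>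
    mean_past_le hn hκ' hlarge (fun i => (hc i).1) e t i hi).trans ?_
  rw [← ENNReal.ofReal_natCast, ← ENNReal.ofReal_natCast, ← ENNReal.ofReal_mul (by positivity),
    ← ENNReal.ofReal_mul (by positivity)]
  refine ENNReal.ofReal_le_ofReal ?_
  have hlen : (((trials n c).length + n : ℕ) : ℝ) ≤ (cmax + 1) * n := by
    have h1 : (trials n c).length ≤ n * cmax := by
      rw [length_trials]
      exact (trialStart_le (fun i => (hc i).2) _).trans
        (Nat.mul_le_mul_right _ (Nat.log_le_self _ _))
    have h2 : (trials n c).length + n ≤ (cmax + 1) * n := by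
      rw [add_mul, one_mul, mul_comm cmax]
      omega
    exact_mod_cast h2
  have hI : (Nat.log 2 (Nat.log 2 n) : ℝ) ≤ n := by
    exact_mod_cast (Nat.log_le_self _ _).trans (Nat.log_le_self _ _)
  set M : ℝ := (e.numGetFree : ℝ) with hM
  set a : ℝ := A * (n : ℝ) ^ α with ha
  have hM0 : 0 ≤ M := Nat.cast_nonneg _
  have ha1 : 1 ≤ a := one_le_mul_of_one_le_of_one_le hA (Real.one_le_rpow hn1 (by linarith))
  have hcount : ((e.numGetFree * (e.numGetFree * ((trials n c).length + n) + 1) : ℕ) : ℝ) ≤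
      a ^ 2 * ((cmax + 2) * n) := by
    have h1 : ((e.numGetFree * (e.numGetFree * ((trials n c).length + n) + 1) : ℕ) : ℝ) =
        M * (M * (((trials n c).length + n : ℕ) : ℝ) + 1) := by
      push_cast
      ring
    rw [h1]
    calc M * (M * (((trials n c).length + n : ℕ) : ℝ) + 1)
        ≤ a * (a * ((cmax + 1) * n) + 1) := by gcongr
      _ ≤ a * (a * ((cmax + 1) * n) + a * n) := by
          gcongr
          exact one_le_mul_of_one_le_of_one_le ha1 hn1
      _ = a ^ 2 * ((cmax + 2) * n) := by ring
  -- The times contribute order `n^(2α+1)`, the levels at most `n`, and each level `24 * n^(1-κ)`.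
  -- One more factor `n` absorbs the constants, including `A`, so that `κ` need not depend on `A` or
  -- `cmax`.
  calc ((e.numGetFree * (e.numGetFree * ((trials n c).length + n) + 1) : ℕ) : ℝ) *
        (Nat.log 2 (Nat.log 2 n) * (24 * n * ((n : ℝ) ^ κ)⁻¹))
      ≤ a ^ 2 * ((cmax + 2) * n) * (n * (24 * n * ((n : ℝ) ^ κ)⁻¹)) := by gcongr
    _ = (24 * A ^ 2 * (cmax + 2)) * (((n : ℝ) ^ α) ^ 2 * (n : ℝ) ^ 3 * ((n : ℝ) ^ κ)⁻¹) := by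
        rw [ha]
        ring
    _ ≤ n * (((n : ℝ) ^ α) ^ 2 * (n : ℝ) ^ 3 * ((n : ℝ) ^ κ)⁻¹) := by gcongr
    _ = (n : ℝ) ^ (2 * α + 4 - κ) := by
        rw [Real.rpow_sub hn0, Real.rpow_add hn0, mul_comm 2 α, Real.rpow_mul hn0.le,
          Real.rpow_natCast, Real.rpow_two]
        have h4 : (n : ℝ) ^ (4 : ℝ) = (n : ℝ) ^ 4 := by exact_mod_cast Real.rpow_natCast (n : ℝ) 4
        rw [h4]
        ring
    _ ≤ (n : ℝ) ^ (-(γ + 2)) := Real.rpow_le_rpow_of_exponent_le hn1 (by linarith)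

theorem natLog_natLog_le (hn : 16 ≤ n) :
    (Nat.log 2 (Nat.log 2 n) : ℝ) ≤ Real.logb 2 (Real.logb 2 n) := by
  have h4 : 4 ≤ Nat.log 2 n := Nat.le_log_of_pow_le (by norm_num) (by simpa using hn)
  have h1 := Real.natLog_le_logb (Nat.log 2 n) 2
  have h2 := Real.natLog_le_logb n 2
  push_cast at h1 h2
  refine h1.trans (Real.logb_le_logb_of_le (by norm_num) ?_ h2)
  exact_mod_cast (by omega : 0 < Nat.log 2 n)

end LevelArray

theorem mainTheorem1 (α γ : ℝ) (hα : 1 < α) (hγ : 0 < γ) :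
    ∃ κ : ℕ, ∀ cmax : ℕ, ∃ C : ℝ, 0 < C ∧ ∀ A : ℝ, ∃ N : ℕ, ∀ n : ℕ, N ≤ n →
      ∀ c : ℕ → ℕ, (∀ i, κ ≤ c i ∧ c i ≤ cmax) →
      ∀ e : LevelArray.Execution n, (e.numGetFree : ℝ) ≤ A * (n : ℝ) ^ α →
      ∀ T : ℕ,
        (∀ (q : Fin n) (k : ℕ), e.IsGet q k → e.expectedCost c T q k ≤ ENNReal.ofReal C) ∧
        ENNReal.ofReal (1 - 1 / (n : ℝ) ^ γ) ≤
          e.probAllGetsWithin c T (C * Real.logb 2 (Real.logb 2 n)) := by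
  set κ : ℕ := ⌈2 * α + γ⌉₊ + 16 with hκ
  have hκ1 : 2 * α + γ + 6 ≤ κ := by
    have := Nat.le_ceil (2 * α + γ)
    rw [hκ]
    push_cast
    linarith
  -- In `cmax + 9`, the `8` is the cost in balanced executions, and `cmax + 1` bounds the worst-case
  -- cost, at most `(cmax + 1) * n`, times the probability `n^(-(γ+2))` of imbalance.
  refine ⟨4 * κ, fun cmax => ⟨cmax + 9, by positivity, fun A => ?_⟩⟩
  obtain ⟨N, hN⟩ := Filter.eventually_atTop.1 ((LevelArray.eventually_log_sq_le κ).and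
    (Filter.eventually_ge_atTop (max 16 ⌈24 * (max A 1) ^ 2 * (cmax + 2)⌉₊)))
  refine ⟨N, fun n hn c hc e he T => ?_⟩
  obtain ⟨hlarge, hn'⟩ := hN n hn
  have hn16 : 16 ≤ n := (le_max_left _ _).trans hn'
  have hnA : 24 * (max A 1) ^ 2 * (cmax + 2) ≤ (n : ℝ) :=
    Nat.ceil_le.1 ((le_max_right _ _).trans hn')
  have hn0 : (0 : ℝ) < n := by exact_mod_cast (by omega : 0 < n)
  have hn1 : (1 : ℝ) ≤ n := by exact_mod_cast (by omega : 1 ≤ n)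
  have he' : (e.numGetFree : ℝ) ≤ max A 1 * (n : ℝ) ^ α := by
    refine he.trans ?_
    gcongr
    exact le_max_left _ _
  have hT := LevelArray.thresholds hn16 (c := c) (fun i => lt_of_lt_of_le (by omega) (hc i).1)
  have hδ := LevelArray.unbalanced_le (γ := γ) hα hκ1 (by omega) (le_max_right A 1) hn16 hlarge
    hnA hc e he' T
  refine ⟨fun q k hk => (hT.expectedCost_le T hδ hk).trans ?_, ?_⟩
  · rw [← ENNReal.ofReal_natCast, ← ENNReal.ofReal_mul (by positivity),
      ← ENNReal.ofReal_ofNat 8, ← ENNReal.ofReal_add (by norm_num) (by positivity)]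
    refine ENNReal.ofReal_le_ofReal ?_
    have h1 : (LevelArray.trials n c).length ≤ n * cmax := by
      rw [LevelArray.length_trials]
      exact (LevelArray.trialStart_le (fun i => (hc i).2) _).trans
        (Nat.mul_le_mul_right _ (Nat.log_le_self _ _))
    have h2 : (((LevelArray.trials n c).length + n : ℕ) : ℝ) ≤ (cmax + 1) * n := by
      have h1' : ((LevelArray.trials n c).length : ℝ) ≤ n * cmax := by exact_mod_cast h1
      push_cast
      linarith
    have h3 : (n : ℝ) ^ (-(γ + 2)) ≤ ((n : ℝ) ^ 2)⁻¹ := by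
      rw [← Real.rpow_two, ← Real.rpow_neg hn0.le]
      exact Real.rpow_le_rpow_of_exponent_le hn1 (by linarith)
    have h4 : (((LevelArray.trials n c).length + n : ℕ) : ℝ) * (n : ℝ) ^ (-(γ + 2)) ≤
        cmax + 1 := by
      calc (((LevelArray.trials n c).length + n : ℕ) : ℝ) * (n : ℝ) ^ (-(γ + 2))
          ≤ ((cmax + 1) * n) * ((n : ℝ) ^ 2)⁻¹ := by gcongr
        _ = (cmax + 1) * (n : ℝ)⁻¹ := by field_simp
        _ ≤ (cmax + 1) * 1 := by
            gcongr
            exact inv_le_one_of_one_le₀ hn1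
        _ = cmax + 1 := mul_one _
    linarith
  · refine le_trans ?_ (hT.le_probAllGetsWithin T hδ ?_)
    · rw [ENNReal.ofReal_sub _ (by positivity), ENNReal.ofReal_one]
      refine tsub_le_tsub_left (ENNReal.ofReal_le_ofReal ?_) _
      rw [one_div, ← Real.rpow_neg hn0.le]
      exact Real.rpow_le_rpow_of_exponent_le hn1 (by linarith)
    · have h1 : (LevelArray.trialStart c (Nat.log 2 (Nat.log 2 n)) : ℝ) ≤
          Nat.log 2 (Nat.log 2 n) * cmax := by
        exact_mod_cast LevelArray.trialStart_le (fun i => (hc i).2) _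
      have h2 := LevelArray.natLog_natLog_le hn16
      refine h1.trans ?_
      rw [mul_comm]
      gcongr
      linarith
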